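/- Throughout, a computable language is a finite or infinite list of relation, function and constant symbols whose kinds and arities are given by a computable function; a structure for it is computable if its domain is $\mathbb{N}$ and its relations, functions and constants are computable, uniformly in the symbol. For tuples $\bar a\in\mathcal{A}$ and $\bar b\in\mathcal{B}$ of the same length $m$, put $(\mathcal{A},\bar a)\leq_0(\mathcal{B},\bar b)$ if $\bar a$ and $\bar b$ satisfy the same unnested atomic formulas ($x=y$, $R(x_1,\dots,x_k)$, $f(x_1,\dots,x_k)=y$) in which only the first $m$ symbols of the language occur, and put $(\mathcal{A},\bar a)\leq_{n+1}(\mathcal{B},\bar b)$ if for every finite tuple $\bar b'\in\mathcal{B}$ there is a tuple $\bar a'\in\mathcal{A}$ of the same length with $(\mathcal{B},\bar b\bar b')\leq_n(\mathcal{A},\bar a\bar a')$. Write $\mathcal{A}\leq_n\mathcal{B}$ if $(\mathcal{A},\varnothing)\leq_n(\mathcal{B},\varnothing)$. In $\mathcal{L}_{\omega_1\omega}$, a $\Sigma_0$ formula, which is the same as a $\Pi_0$ formula, is a finitary quantifier-free formula; a $\Sigma_{n+1}$ formula is a countable disjunction $\bigvee_i\exists\bar x_i\,\psi_i$ with each $\psi_i$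 a $\Pi_n$ formula, and a $\Pi_{n+1}$ formula is a countable conjunction $\bigwedge_i\forall\bar x_i\,\psi_i$ with each $\psi_i$ a $\Sigma_n$ formula. Such a formula is $\mathbf{d}$-computable if, with the index sets taken to be subsets of $\mathbb{N}$, its syntax tree, labelled with the lengths of the quantified tuples and with the Gödel numbers of the quantifier-free formulas at the leaves, is computable from $\mathbf{d}$. Finally, $\mathbf{0}^{(k)}$ is the $k$-th Turing jump of the empty set. \textbf{Theorem.} Let $n\geq 1$, and let $\mathcal{A}$ and $\mathcal{B}$ be computable structures for the same computable language such that $\mathcal{A}\not\leq_n\mathcal{B}$. Then there is a $\mathbf{0}^{(n-1)}$-computable $\Pi_n$ sentence $\varphi$ such that $\mathcal{A}\models\varphi$ and $\mathcal{B}\not\models\varphi$. -/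

import Mathlib

/-! ### Relative computability and the jump -/

/-- Programs for partial functions computable relative to an oracle; the constructors are those
of `Nat.RecursiveIn`. -/
inductive OracleCode : Type
  | zero : OracleCode
  | succ : OracleCode
  | left : OracleCode
  | right : OracleCode
  | oracle : OracleCode
  | pair : OracleCode → OracleCode → OracleCode
  | comp : OracleCode → OracleCode → OracleCode
  | prec : OracleCode → OracleCode → OracleCode
  | rfind : OracleCode → OracleCode

namespace OracleCode

/-- The partial function computed by a program with oracle `g`. -/
def eval (g : ℕ →. ℕ) : OracleCode → ℕ →. ℕ
  | zero => fun _ => Part.some 0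
  | succ => fun n => Part.some (n + 1)
  | left => fun n => Part.some (Nat.unpair n).1
  | right => fun n => Part.some (Nat.unpair n).2
  | oracle => g
  | pair c d => fun n => Nat.pair <$> eval g c n <*> eval g d n
  | comp c d => fun n => eval g d n >>= eval g c
  | prec c d => fun p =>
      (Nat.unpair p).2.rec (eval g c (Nat.unpair p).1) fun y IH =>
        IH >>= fun i => eval g d (Nat.pair (Nat.unpair p).1 (Nat.pair y i))
  | rfind c => fun a =>
      Nat.rfind fun n => (fun m => decide (m = 0)) <$> eval g c (Nat.pair a n)

/-- Gödel numbers of programs. -/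
def number : OracleCode → ℕ
  | zero => Nat.pair 0 0
  | succ => Nat.pair 1 0
  | left => Nat.pair 2 0
  | right => Nat.pair 3 0
  | oracle => Nat.pair 4 0
  | pair c d => Nat.pair 5 (Nat.pair c.number d.number)
  | comp c d => Nat.pair 6 (Nat.pair c.number d.number)
  | prec c d => Nat.pair 7 (Nat.pair c.number d.number)
  | rfind c => Nat.pair 8 c.number

end OracleCode

open Classical in
/-- The characteristic function of a set of natural numbers, as an oracle. -/
noncomputable def charOracle (X : Set ℕ) : ℕ →. ℕ :=
  fun n => Part.some (if n ∈ X then 1 else 0)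

/-- The Turing jump: the set of (numbers of) programs that halt on their own number
with oracle `X`. -/
def turingJump (X : Set ℕ) : Set ℕ :=
  {e | ∃ c : OracleCode, c.number = e ∧ (c.eval (charOracle X) e).Dom}

/-- `zeroJump n` is the `n`-th jump of the empty set. -/
def zeroJump : ℕ → Set ℕ
  | 0 => ∅
  | n + 1 => turingJump (zeroJump n)

/-! ### Computable languages and structures -/

/-- A computable first-order signature: a finite or infinite list of symbols, where
`symb i = some (Sum.inl k)` says that the `i`-th symbol is a `k`-ary relation symbol,
`symb i = some (Sum.inr k)` that it is a `k`-ary function symbol (a constant if `k = 0`), and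
`symb i = none` that there are at most `i` symbols. -/
structure CompSignature where
  symb : ℕ → Option (ℕ ⊕ ℕ)
  initial : ∀ i, symb i = none → symb (i + 1) = none
  computable : Computable symb

/-- The language of a signature. -/
def CompSignature.language (S : CompSignature) : FirstOrder.Language.{0, 0} where
  Functions k := {i : ℕ // S.symb i = some (Sum.inr k)}
  Relations k := {i : ℕ // S.symb i = some (Sum.inl k)}

/-- A structure with domain `ℕ` is computable if its functions and relations are computable,
uniformly in the symbol. -/
def IsComputableStructure (S : CompSignature) (A : S.language.Structure ℕ) : Prop :=
  (∃ F : ℕ × List ℕ → ℕ, Computable F ∧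
    ∀ (k : ℕ) (f : S.language.Functions k) (v : Fin k → ℕ),
      F (f.1, List.ofFn v) = A.funMap f v) ∧
  (∃ R : ℕ × List ℕ → Bool, Computable R ∧
    ∀ (k : ℕ) (r : S.language.Relations k) (v : Fin k → ℕ),
      R (r.1, List.ofFn v) = true ↔ A.RelMap r v)

/-! ### Back-and-forth relations -/

/-- The `m`-tuples `a` and `b` satisfy the same atomic formulas `x = y`, `r(x₁, …, xₖ)` and
`f(x₁, …, xₖ) = y`, with `r` and `f` among the first `m` symbols of the signature. -/
def SameAtomic (S : CompSignature) {M N : Type} (A : S.language.Structure M)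
    (B : S.language.Structure N) {m : ℕ} (a : Fin m → M) (b : Fin m → N) : Prop :=
  (∀ i j : Fin m, a i = a j ↔ b i = b j) ∧
  (∀ (k : ℕ) (r : S.language.Relations k), r.1 < m → ∀ t : Fin k → Fin m,
    A.RelMap r (fun i => a (t i)) ↔ B.RelMap r (fun i => b (t i))) ∧
  (∀ (k : ℕ) (f : S.language.Functions k), f.1 < m → ∀ (t : Fin k → Fin m) (j : Fin m),
    A.funMap f (fun i => a (t i)) = a j ↔ B.funMap f (fun i => b (t i)) = b j)

/-- The asymmetric back-and-forth relation `(A, a) ≤ₙ (B, b)` between tuples of the same length. -/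
def BackForth (S : CompSignature) : (n : ℕ) → {M N : Type} → (A : S.language.Structure M) →
    (B : S.language.Structure N) → {m : ℕ} → (a : Fin m → M) → (b : Fin m → N) → Prop
  | 0, _, _, A, B, _, a, b => SameAtomic S A B a b
  | n + 1, M, N, A, B, _, a, b =>
      ∀ (k : ℕ) (b' : Fin k → N), ∃ a' : Fin k → M,
        BackForth S n B A (Fin.append b b') (Fin.append a a')

/-- The relation `A ≤ₙ B` between structures. -/
def StructureLE (S : CompSignature) (n : ℕ) {M N : Type} (A : S.language.Structure M)
    (B : S.language.Structure N) : Prop :=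
  BackForth S n A B (Fin.elim0 : Fin 0 → M) (Fin.elim0 : Fin 0 → N)

/-! ### Infinitary formulas of finite complexity -/

inductive FormulaSort : Type
  | sigma : FormulaSort
  | pi : FormulaSort

/-- `InfFormula S sigma n m` and `InfFormula S pi n m` are the `Σₙ` and the `Πₙ` formulas of
`L_{ω₁ω}` with free variables `x₀, …, x_{m-1}`: for `n = 0` the finitary quantifier-free formulas;
a `Σ_{n+1}` formula is a countable disjunction of formulas `∃ ȳᵢ ψᵢ(x̄, ȳᵢ)` with `ψᵢ` a `Πₙ`
formula, and a `Π_{n+1}` formula is a countable conjunction of formulas `∀ ȳᵢ ψᵢ(x̄, ȳᵢ)` with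
`ψᵢ` a `Σₙ` formula. Here `I` is the index set and `len i` the length of `ȳᵢ`. -/
inductive InfFormula (S : CompSignature) : FormulaSort → ℕ → ℕ → Type
  | qf {p : FormulaSort} {m : ℕ} (θ : S.language.Formula (Fin m)) (hθ : θ.IsQF) :
      InfFormula S p 0 m
  | disj {n m : ℕ} (I : Set ℕ) (len : I → ℕ)
      (ψ : (i : I) → InfFormula S FormulaSort.pi n (m + len i)) :
      InfFormula S FormulaSort.sigma (n + 1) m
  | conj {n m : ℕ} (I : Set ℕ) (len : I → ℕ)
      (ψ : (i : I) → InfFormula S FormulaSort.sigma n (m + len i)) :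
      InfFormula S FormulaSort.pi (n + 1) m

namespace InfFormula

variable {S : CompSignature}

/-- Truth of a formula in a structure under an assignment of its free variables. -/
def Realize {M : Type} (A : S.language.Structure M) :
    {p : FormulaSort} → {n m : ℕ} → InfFormula S p n m → (Fin m → M) → Prop
  | _, _, _, qf θ _, v => @FirstOrder.Language.Formula.Realize S.language M A _ θ v
  | _, _, _, disj I len ψ, v =>
      ∃ (i : I) (w : Fin (len i) → M), Realize A (ψ i) (Fin.append v w)
  | _, _, _, conj I len ψ, v =>
      ∀ (i : I) (w : Fin (len i) → M), Realize A (ψ i) (Fin.append v w)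

end InfFormula

/-- Truth of a `Πₙ` or `Σₙ` sentence in a structure. -/
def SentenceHolds {S : CompSignature} {M : Type} (A : S.language.Structure M)
    {p : FormulaSort} {n : ℕ} (φ : InfFormula S p n 0) : Prop :=
  φ.Realize A (Fin.elim0 : Fin 0 → M)

/-- Gödel numbers of terms. -/
def termNumber {S : CompSignature} {α : Type} [Encodable α] : S.language.Term α → ℕ
  | .var x => Nat.pair 0 (Encodable.encode x)
  | .func f ts =>
      Nat.pair 1 (Nat.pair f.1 (Encodable.encode (List.ofFn fun i => termNumber (ts i))))

/-- Gödel numbers of finitary formulas. -/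
def formulaNumber {S : CompSignature} {m : ℕ} :
    {l : ℕ} → S.language.BoundedFormula (Fin m) l → ℕ
  | _, .falsum => Nat.pair 0 0
  | _, .equal t u => Nat.pair 1 (Nat.pair (termNumber t) (termNumber u))
  | _, .rel r ts =>
      Nat.pair 2 (Nat.pair r.1 (Encodable.encode (List.ofFn fun i => termNumber (ts i))))
  | _, .imp θ χ => Nat.pair 3 (Nat.pair (formulaNumber θ) (formulaNumber χ))
  | _, .all θ => Nat.pair 4 (formulaNumber θ)

namespace InfFormula

variable {S : CompSignature}

open Classical in
/-- The labelled syntax tree of a formula. A node is the list of the indices chosen on the way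
from the root. A list that is not a node has no label. The label of a node consists of the length
of the tuple of variables quantified directly above it (`k` at the root) and, at a leaf, of the
Gödel number of the quantifier-free formula there. -/
noncomputable def tree : {p : FormulaSort} → {n m : ℕ} → InfFormula S p n m → (k : ℕ) →
    List ℕ → Option (ℕ × ℕ)
  | _, _, _, qf θ _, k, [] => some (k, formulaNumber θ)
  | _, _, _, qf _ _, _, _ :: _ => none
  | _, _, _, disj _ _ _, k, [] => some (k, 0)
  | _, _, _, disj I len ψ, _, i :: σ =>
      if h : i ∈ I then tree (ψ ⟨i, h⟩) (len ⟨i, h⟩) σ else none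
  | _, _, _, conj _ _ _, k, [] => some (k, 0)
  | _, _, _, conj I len ψ, _, i :: σ =>
      if h : i ∈ I then tree (ψ ⟨i, h⟩) (len ⟨i, h⟩) σ else none

/-- A formula is `X`-computable if its labelled syntax tree is computable with oracle `X`. -/
def ComputableFrom (X : Set ℕ) {p : FormulaSort} {n m : ℕ} (φ : InfFormula S p n m) : Prop :=
  ComputableIn {charOracle X} (fun σ : List ℕ => φ.tree 0 σ)

end InfFormula

/-! ### Relative computability -/

section RelativeComputability

open Encodable

/-! Let the level be n + 1. If A ≤ₙ₊₁ B fails, there is a tuple b of B such that (B, b) ≤ₙ (A, a)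
for no tuple a of A. It therefore suffices to find a Σₙ formula that holds in A of every tuple of
that length and fails in B of b; its universal closure is the sentence. The induction needs a
stronger claim (`Separates`): if no extension a⁺ of a satisfies (B, b) ≤ₙ (A, a⁺), some Σₙ formula
holds in A of all tuples extending a and fails in B of b. The theorem uses the empty a.

For n = 0 the formula says that the variables do not have the atomic type of b
(`exists_separates_zero`). At n + 1 it is the disjunction of ∃y ¬H(x, y) over all a' extending a
with at least |b| entries, where H is the Σₙ formula for the pair (a', b) with A and B exchanged. It
holds in A of any v extending a: the failure of (B, b) ≤ₙ₊₁ (A, v) is witnessed by some a' extending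
v, and H fails at a'. It fails in B of b, because H holds in B of every extension of b
(`exists_separates_succ`).

This uses only those a' for which b has no extension b⁺ with (A, a') ≤ₙ (B, b⁺). The bad a' form a
Σ₂ₙ₊₁ set, in general too complex for 0⁽ⁿ⁺¹⁾ to decide. Instead the condition is written into the
formula: a Σ₂ₙ₊₁ predicate is Σₙ relative to 0⁽ⁿ⁺¹⁾ (`SigmaIn.zeroJump`), hence expressed by
0⁽ⁿ⁺¹⁾-computable Σₙ formulas built from ⊤ and ⊥ (`SigmaIn.exists_uniformlyIn`). Adding these to H
as a disjunct makes H true everywhere for bad a' (`Separates.exists_total`), so that ¬H contributes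
nothing. The index set stays computable, and 0⁽ⁿ⁺¹⁾ suffices at level n + 1. -/

theorem ComputableIn.comp {α β σ : Type} [Primcodable α] [Primcodable β] [Primcodable σ]
    {O : Set (ℕ →. ℕ)} {f : β → σ} {g : α → β} (hf : ComputableIn O f) (hg : ComputableIn O g) :
    ComputableIn O fun a => f (g a) := by
  refine (Nat.RecursiveIn.comp hf hg).of_eq fun n => ?_
  cases e : (decode n : Option α) <;> simp [encodek]

theorem ComputableIn.pair {α β σ : Type} [Primcodable α] [Primcodable β] [Primcodable σ]
    {O : Set (ℕ →. ℕ)} {f : α → β} {g : α → σ} (hf : ComputableIn O f) (hg : ComputableIn O g) :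
    ComputableIn O fun a => (f a, g a) := by
  refine (Nat.RecursiveIn.pair hf hg).of_eq fun n => ?_
  cases e : (decode n : Option α) <;> simp [Seq.seq]

theorem ComputableIn.of_eq {α σ : Type} [Primcodable α] [Primcodable σ] {O : Set (ℕ →. ℕ)}
    {f g : α → σ} (hf : ComputableIn O f) (h : ∀ a, f a = g a) : ComputableIn O g :=
  (funext h : f = g) ▸ hf

namespace OracleCode

theorem exists_eval_eq {g f : ℕ →. ℕ} (hf : Nat.RecursiveIn {g} f) :
    ∃ c : OracleCode, c.eval g = f := by
  induction hf with
  | zero => exact ⟨zero, rfl⟩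
  | succ => exact ⟨succ, rfl⟩
  | left => exact ⟨left, rfl⟩
  | right => exact ⟨right, rfl⟩
  | oracle h hh => obtain rfl := Set.mem_singleton_iff.mp hh; exact ⟨oracle, rfl⟩
  | pair _ _ h₁ h₂ =>
    obtain ⟨c, rfl⟩ := h₁
    obtain ⟨d, rfl⟩ := h₂
    exact ⟨pair c d, rfl⟩
  | comp _ _ h₁ h₂ =>
    obtain ⟨c, rfl⟩ := h₁
    obtain ⟨d, rfl⟩ := h₂
    exact ⟨comp c d, rfl⟩
  | prec _ _ h₁ h₂ =>
    obtain ⟨c, rfl⟩ := h₁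
    obtain ⟨d, rfl⟩ := h₂
    exact ⟨prec c d, rfl⟩
  | rfind _ h =>
    obtain ⟨c, rfl⟩ := h
    exact ⟨rfind c, rfl⟩

theorem number_injective : Function.Injective number := by
  intro c
  induction c with
  | zero | succ | left | right | oracle => intro d h; cases d <;> simp_all [number]
  | pair c₁ c₂ h₁ h₂ =>
    intro d h
    cases d <;> simp [number] at h
    rw [h₁ h.1, h₂ h.2]
  | comp c₁ c₂ h₁ h₂ =>
    intro d h
    cases d <;> simp [number] at h
    rw [h₁ h.1, h₂ h.2]
  | prec c₁ c₂ h₁ h₂ =>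
    intro d h
    cases d <;> simp [number] at h
    rw [h₁ h.1, h₂ h.2]
  | rfind c₁ h₁ =>
    intro d h
    cases d <;> simp [number] at h
    rw [h₁ h]

/-- A program for the constant function with value `k`. -/
def const : ℕ → OracleCode
  | 0 => zero
  | k + 1 => comp succ (const k)

theorem eval_const (g : ℕ →. ℕ) (k n : ℕ) : (const k).eval g n = Part.some k := by
  induction k with
  | zero => rfl
  | succ k ih => simp [const, eval, ih]

theorem primrec_number_const : Primrec fun k => (const k).number := by
  refine (Primrec.nat_rec₁ (f := fun _ r => Nat.pair 6 (Nat.pair succ.number r)) zero.number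
    ?_).of_eq fun k => ?_
  · exact Primrec₂.natPair.comp (Primrec.const 6)
      (Primrec₂.natPair.comp (Primrec.const _) Primrec.snd)
  · induction k with
    | zero => rfl
    | succ k ih => simp only [const, number] at ih ⊢; rw [← ih]

end OracleCode

/-- An existential quantifier over an `X`-computable predicate is decided by the jump of `X`. -/
theorem ComputableIn.exists_jump {α : Type} [Primcodable α] {X : Set ℕ} {p : α × ℕ → Bool}
    (hp : ComputableIn {charOracle X} p) :
    ∃ q : α → Bool, ComputableIn {charOracle (turingJump X)} q ∧
      ∀ a, q a = true ↔ ∃ n, p (a, n) = true := by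
  classical
  -- Unbounded search stops at the value `0`, so truth is coded by `0`.
  have hf : ComputableIn {charOracle X} fun x => cond (p x) 0 1 :=
    ComputableIn.comp (f := fun b : Bool => cond b 0 1)
      (Primrec.dom_finite _).computableIn hp
  obtain ⟨c, hc⟩ := OracleCode.exists_eval_eq hf
  -- This program ignores its input and searches for a witness for `a`; hence it halts on its own
  -- number, which is what the jump records, exactly when a witness exists.
  let e : α → OracleCode := fun a => .comp (.rfind c) (.const (encode a))
  have he : Computable fun a => (e a).number := by
    refine (Primrec₂.natPair.comp (Primrec.const 6) (Primrec₂.natPair.comp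
      (Primrec.const (OracleCode.rfind c).number)
      (OracleCode.primrec_number_const.comp Primrec.encode))).to_comp
  let χ : ℕ → ℕ := fun n => if n ∈ turingJump X then 1 else 0
  have hχ : ComputableIn {charOracle (turingJump X)} χ :=
    RecursiveIn.oracle (charOracle (turingJump X)) rfl
  refine ⟨fun a => decide (χ (e a).number = 1), ?_, fun a => ?_⟩
  · exact ComputableIn.comp (f := fun n : ℕ => decide (n = 1))
      (Primrec.eq.decide.comp Primrec.id (Primrec.const 1)).computableIn
      (hχ.comp he.computableIn)
  · have h₁ : χ (e a).number = 1 ↔ ((e a).eval (charOracle X) (e a).number).Dom := by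
      have h : (e a).number ∈ turingJump X ↔
          ((e a).eval (charOracle X) (e a).number).Dom :=
        ⟨fun ⟨d, hd, h⟩ => OracleCode.number_injective hd ▸ h, fun h => ⟨_, rfl, h⟩⟩
      rw [← h]
      simp [χ]
    have h₂ : (e a).eval (charOracle X) (e a).number =
        Nat.rfind fun n => Part.some (p (a, n)) := by
      simp only [e, OracleCode.eval, OracleCode.eval_const, hc, Part.bind_eq_bind, Part.bind_some]
      congr 1
      funext n
      cases h : p (a, n) <;> simp [h]
    simp only [h₁, h₂, decide_eq_true_eq]
    exact Nat.rfind_dom.trans ⟨fun ⟨n, h, _⟩ => ⟨n, (Part.mem_some_iff.mp h).symm⟩,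
      fun ⟨n, h⟩ => ⟨n, Part.mem_some_iff.mpr h.symm, fun _ => trivial⟩⟩

/-! ### The arithmetical hierarchy relative to an oracle -/

/-- The levels `Σₖ(X)` of the arithmetical hierarchy relative to `X`, where `Σ₀(X)` consists of the
`X`-computable predicates. -/
def SigmaIn (X : Set ℕ) : ℕ → {α : Type} → [Primcodable α] → (α → Prop) → Prop
  | 0, α, _, r => ∃ q : α → Bool, ComputableIn {charOracle X} q ∧ ∀ a, q a = true ↔ r a
  | k + 1, α, _, r => ∃ s : α × ℕ → Prop, SigmaIn X k s ∧ ∀ a, r a ↔ ∃ i, ¬ s (a, i)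

namespace SigmaIn

variable {X Y : Set ℕ} {α β : Type} [Primcodable α] [Primcodable β]

theorem comp {k : ℕ} {r : β → Prop} (hr : SigmaIn X k r) {f : α → β} (hf : Computable f) :
    SigmaIn X k fun a => r (f a) := by
  induction k generalizing α β with
  | zero =>
    obtain ⟨q, hq, h⟩ := hr
    exact ⟨fun a => q (f a), hq.comp hf.computableIn, fun a => h (f a)⟩
  | succ k ih =>
    obtain ⟨s, hs, h⟩ := hr
    exact ⟨fun x => s (f x.1, x.2), ih hs (f := fun x : α × ℕ => (f x.1, x.2))
      ((hf.comp Computable.fst).pair Computable.snd), fun a => h (f a)⟩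

/-- The new oracle absorbs the innermost quantifier, the one next to the computable matrix; the
outer quantifiers are carried along unchanged. -/
theorem jump {k : ℕ} {r : α → Prop} (hr : SigmaIn X (k + 1) r) :
    SigmaIn (turingJump X) k r := by
  induction k generalizing α with
  | zero =>
    obtain ⟨s, ⟨q, hq, hs⟩, h⟩ := hr
    obtain ⟨q', hq', h'⟩ := ComputableIn.exists_jump (p := fun x => !q x)
      (ComputableIn.comp Primrec.not.computableIn hq)
    refine ⟨q', hq', fun a => ?_⟩
    simp [h', h, ← hs]
  | succ k ih =>
    obtain ⟨s, hs, h⟩ := hr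
    exact ⟨s, ih hs, h⟩

theorem mono (hXY : TuringReducible (charOracle X) (charOracle Y)) {k : ℕ} {r : α → Prop}
    (hr : SigmaIn X k r) : SigmaIn Y k r := by
  induction k generalizing α with
  | zero =>
    obtain ⟨q, hq, h⟩ := hr
    exact ⟨q, RecursiveIn.subst hq (by simpa using hXY), h⟩
  | succ k ih =>
    obtain ⟨s, hs, h⟩ := hr
    exact ⟨s, ih hs, h⟩

/-- The quantifier runs over codes; a number that is no code stands for `default`, which is harmless
under an existential quantifier. -/
theorem exists_not [Inhabited β] {k : ℕ} {s : α × β → Prop} (hs : SigmaIn X k s) :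
    SigmaIn X (k + 1) fun a => ∃ b, ¬ s (a, b) := by
  refine ⟨fun x => s (x.1, (decode x.2).getD default), hs.comp (Computable.fst.pair
    ((Computable.decode.comp Computable.snd).option_getD (Computable.const default))),
    fun a => ⟨fun ⟨b, hb⟩ => ⟨encode b, by simpa using hb⟩, fun ⟨i, hi⟩ => ⟨_, hi⟩⟩⟩

/-- The negation under the quantifier exchanges conjunction and disjunction, so the two claims must
be proved together. -/
theorem and_or {k : ℕ} {r : α → Prop} (hr : SigmaIn X k r) {q : α → Bool} (hq : Computable q) :
    SigmaIn X k (fun a => q a = true ∧ r a) ∧ SigmaIn X k (fun a => q a = true ∨ r a) := by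
  induction k generalizing α with
  | zero =>
    obtain ⟨q', hq', h⟩ := hr
    refine ⟨⟨fun a => q a && q' a, ?_, by simp [h]⟩, ⟨fun a => q a || q' a, ?_, by simp [h]⟩⟩
    · exact ComputableIn.comp (f := fun x : Bool × Bool => x.1 && x.2)
        Primrec.and.computableIn (hq.computableIn.pair hq')
    · exact ComputableIn.comp (f := fun x : Bool × Bool => x.1 || x.2)
        Primrec.or.computableIn (hq.computableIn.pair hq')
  | succ k ih =>
    obtain ⟨s, hs, h⟩ := hr
    obtain ⟨h₁, h₂⟩ := ih hs (q := fun x => !q x.1)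
      (Primrec.not.to_comp.comp (hq.comp Computable.fst))
    refine ⟨⟨_, h₂, fun a => ?_⟩, ⟨_, h₁, fun a => ?_⟩⟩
    · simp [h]
    · cases hq' : q a <;> simp [h, hq']

end SigmaIn

/-- Every set is computable in its jump. -/
theorem charOracle_turingReducible_jump (X : Set ℕ) :
    TuringReducible (charOracle X) (charOracle (turingJump X)) := by
  classical
  let χ : ℕ → ℕ := fun n => if n ∈ X then 1 else 0
  have hχ : ComputableIn {charOracle X} χ := RecursiveIn.oracle (charOracle X) rfl
  -- Membership in `X` is treated as an existential statement whose quantified variable `x.2` is a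
  -- dummy.
  obtain ⟨q, hq, h⟩ := ComputableIn.exists_jump (p := fun x : ℕ × ℕ => decide (χ x.1 = 1))
    (ComputableIn.comp (f := fun n : ℕ => decide (n = 1))
      (Primrec.eq.decide.comp Primrec.id (Primrec.const 1)).computableIn
      (hχ.comp ComputableIn.fst))
  have : ComputableIn {charOracle (turingJump X)} χ := by
    refine (ComputableIn.comp (f := fun b : Bool => cond b 1 0)
      (Primrec.dom_finite _).computableIn hq).of_eq fun n => ?_
    have := h n
    by_cases hn : n ∈ X <;> cases hb : q n <;> simp_all [χ]
  exact this

theorem zeroJump_mono {i j : ℕ} (hij : i ≤ j) :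
    TuringReducible (charOracle (zeroJump i)) (charOracle (zeroJump j)) := by
  induction j, hij using Nat.le_induction with
  | base => exact TuringReducible.rfl
  | succ j _ ih => exact ih.trans (charOracle_turingReducible_jump _)

/-- Each jump pays for one quantifier, always the innermost one remaining. -/
theorem SigmaIn.zeroJump {α : Type} [Primcodable α] {k t : ℕ} {r : α → Prop}
    (hr : SigmaIn ∅ (k + t) r) : SigmaIn (zeroJump t) k r := by
  induction t generalizing k with
  | zero => exact hr
  | succ t ih => exact (ih (k := k + 1) (by rwa [Nat.add_right_comm])).jump

end RelativeComputability

/-! ### Computable operations on lists -/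

namespace Computable

variable {α β γ σ : Type} [Primcodable α] [Primcodable β] [Primcodable γ] [Primcodable σ]

/-- The fold is a recursion on the number of entries consumed, the next entry being read off by list
lookup. The other list operations reduce to this one. -/
theorem list_foldl {f : α → List β} {g : α → σ} {h : α → σ × β → σ} (hf : Computable f)
    (hg : Computable g) (hh : Computable₂ h) :
    Computable fun a => (f a).foldl (fun s b => h a (s, b)) (g a) := by
  have step : Computable₂ fun (a : α) (p : ℕ × σ) =>
      Option.casesOn (motive := fun _ => σ) (f a)[p.1]? p.2 fun b => h a (p.2, b) := by
    refine Computable.option_casesOn (Computable.list_getElem?.comp (hf.comp Computable.fst)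
      (Computable.fst.comp Computable.snd)) (Computable.snd.comp Computable.snd) ?_
    exact hh.comp (Computable.fst.comp Computable.fst)
      ((Computable.snd.comp (Computable.snd.comp Computable.fst)).pair Computable.snd)
  refine (Computable.nat_rec (Computable.list_length.comp hf) hg step).of_eq fun a => ?_
  have key : ∀ n, Nat.rec (motive := fun _ => σ) (g a) (fun y IH =>
      Option.casesOn (motive := fun _ => σ) (f a)[(y, IH).1]? (y, IH).2
        fun b => h a ((y, IH).2, b)) n =
      ((f a).take n).foldl (fun s b => h a (s, b)) (g a) := by
    intro n
    induction n with
    | zero => rfl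
    | succ n ih =>
      rw [List.take_add_one, List.foldl_append, ← ih]
      show Option.casesOn (motive := fun _ => σ) (f a)[n]? _ _ = _
      rcases (f a)[n]? with _ | b <;> rfl
  simpa using key (f a).length

theorem list_foldr {f : α → List β} {g : α → σ} {h : α → β × σ → σ} (hf : Computable f)
    (hg : Computable g) (hh : Computable₂ h) :
    Computable fun a => (f a).foldr (fun b s => h a (b, s)) (g a) := by
  refine (list_foldl (h := fun a p => h a (p.2, p.1)) (Computable.list_reverse.comp hf) hg
    ?_).of_eq fun a => by simp
  exact hh.comp Computable.fst ((Computable.snd.comp Computable.snd).pair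
    (Computable.fst.comp Computable.snd))

theorem list_map {f : α → List β} {g : α → β → σ} (hf : Computable f) (hg : Computable₂ g) :
    Computable fun a => (f a).map (g a) := by
  refine (list_foldr (h := fun a p => g a p.1 :: p.2) hf (Computable.const []) ?_).of_eq
    fun a => ?_
  · exact Computable.list_cons.comp (hg.comp Computable.fst (Computable.fst.comp Computable.snd))
      (Computable.snd.comp Computable.snd)
  · induction f a <;> simp_all

theorem list_flatMap {f : α → List β} {g : α → β → List σ} (hf : Computable f)
    (hg : Computable₂ g) : Computable fun a => (f a).flatMap (g a) := by
  refine (list_foldr (h := fun a p => g a p.1 ++ p.2) hf (Computable.const []) ?_).of_eq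
    fun a => ?_
  · exact Computable.list_append.comp
      (hg.comp Computable.fst (Computable.fst.comp Computable.snd))
      (Computable.snd.comp Computable.snd)
  · induction f a <;> simp_all

theorem list_all {f : α → List β} {g : α → β → Bool} (hf : Computable f)
    (hg : Computable₂ g) : Computable fun a => (f a).all (g a) := by
  refine (list_foldr (h := fun a p => g a p.1 && p.2) hf (Computable.const true) ?_).of_eq
    fun a => ?_
  · exact Primrec.and.to_comp.comp
      (hg.comp Computable.fst (Computable.fst.comp Computable.snd))
      (Computable.snd.comp Computable.snd)
  · induction f a <;> simp_all

end Computable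

/-! ### The finitary formulas describing the atomic type of a tuple -/

/-- The lists of length `k` with entries below `m`. -/
def boundedLists (m : ℕ) : ℕ → List (List ℕ)
  | 0 => [[]]
  | k + 1 => (boundedLists m k).flatMap fun t => (List.range m).map fun x => x :: t

theorem mem_boundedLists {m k : ℕ} {t : List ℕ} :
    t ∈ boundedLists m k ↔ t.length = k ∧ ∀ x ∈ t, x < m := by
  induction k generalizing t with
  | zero => simp +contextual [boundedLists]
  | succ k ih =>
    cases t with
    | nil => simp [boundedLists]
    | cons x t => simp [boundedLists, ih]; tauto

theorem computable_boundedLists : Computable₂ boundedLists := by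
  refine (Primrec.nat_rec (f := fun _ : ℕ => [[]])
    (g := fun m (p : ℕ × List (List ℕ)) =>
      p.2.flatMap fun t => (List.range m).map fun x => x :: t)
    (Primrec.const _) ?_).to_comp.of_eq fun x => ?_
  · refine Primrec.list_flatMap (Primrec.snd.comp Primrec.snd) ?_
    exact Primrec.list_map (Primrec.list_range.comp (Primrec.fst.comp Primrec.fst))
      (Primrec.list_cons.comp Primrec.snd (Primrec.snd.comp Primrec.fst))
  · obtain ⟨m, k⟩ := x
    induction k with
    | zero => rfl
    | succ k ih => simp only [boundedLists] at ih ⊢; rw [← ih]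

namespace CompSignature

open FirstOrder FirstOrder.Language

variable (S : CompSignature)

/-- The number of arguments of the `i`-th symbol; the index `0` stands for equality and `i + 1`
for the `i`-th symbol of the signature. In an equality or in an equation `f(x₁, …, xₖ) = y` the
right-hand side is not counted. -/
def argCount (i : ℕ) : ℕ :=
  Nat.casesOn i 1 fun i => (S.symb i).elim 0 (Sum.elim id id)

/-- Descriptions `(i, t, j)` of the unnested atomic formulas in `m` variables and the first `m`
symbols. -/
def atoms (m : ℕ) : List (ℕ × List ℕ × ℕ) :=
  (List.range (m + 1)).flatMap fun i => (boundedLists m (S.argCount i)).flatMap fun t =>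
    (List.range m).map fun j => (i, t, j)

theorem mem_atoms {m i j : ℕ} {t : List ℕ} : (i, t, j) ∈ S.atoms m ↔
    i ≤ m ∧ t.length = S.argCount i ∧ (∀ x ∈ t, x < m) ∧ j < m := by
  simp [atoms, mem_boundedLists, and_assoc]

theorem computable_argCount : Computable S.argCount := by
  have h : Computable fun i => (S.symb i).elim 0 (Sum.elim id id) := by
    refine (Computable.option_casesOn S.computable (Computable.const 0)
      (g := fun _ s => Sum.elim id id s) ?_).of_eq fun i => ?_
    · exact (Computable.sumCasesOn Computable.snd Computable.snd.to₂ Computable.snd.to₂).of_eq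
        fun x => by rcases x with ⟨_, _ | _⟩ <;> rfl
    · cases S.symb i <;> rfl
  exact Computable.nat_casesOn Computable.id (Computable.const 1) (h.comp Computable.snd).to₂

theorem computable_atoms : Computable S.atoms := by
  refine Computable.list_flatMap (Primrec.list_range.comp Primrec.succ).to_comp ?_
  refine Computable.list_flatMap (computable_boundedLists.comp Computable.fst
    (S.computable_argCount.comp Computable.snd)) ?_
  refine Computable.list_map (Primrec.list_range.to_comp.comp
    (Computable.fst.comp Computable.fst)) ?_
  exact (Computable.snd.comp (Computable.fst.comp Computable.fst)).pair
    ((Computable.snd.comp Computable.fst).pair Computable.snd)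

variable {S}

/-- The term consisting of a variable. -/
def varTerm {m x : ℕ} (hx : x < m) : S.language.Term (Fin m ⊕ Fin 0) :=
  .var (Sum.inl ⟨x, hx⟩)

open Classical in
/-- The atomic formula with a given description, and `⊥` if there is none. -/
noncomputable def atomFormula (m : ℕ) : ℕ × List ℕ × ℕ → S.language.Formula (Fin m)
  | (0, t, j) => if h : t.headI < m ∧ j < m then .equal (varTerm h.1) (varTerm h.2) else .falsum
  | (i + 1, t, j) =>
    if h : S.symb i = some (Sum.inl t.length) ∧ ∀ x ∈ t, x < m then
      .rel (⟨i, h.1⟩ : S.language.Relations t.length)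
        fun q => varTerm (h.2 _ (t.get_mem q))
    else if h : S.symb i = some (Sum.inr t.length) ∧ (∀ x ∈ t, x < m) ∧ j < m then
      .equal (.func (⟨i, h.1⟩ : S.language.Functions t.length)
        fun q => varTerm (h.2.1 _ (t.get_mem q))) (varTerm h.2.2)
    else .falsum

theorem atomFormula_equal {m x j : ℕ} (hx : x < m) (hj : j < m) :
    (atomFormula m (0, [x], j) : S.language.Formula (Fin m)) =
      .equal (varTerm hx) (varTerm hj) := by
  rw [atomFormula, dif_pos ⟨hx, hj⟩]
  rfl

theorem atomFormula_rel {m i j : ℕ} {t : List ℕ} (h : S.symb i = some (Sum.inl t.length))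
    (ht : ∀ x ∈ t, x < m) : (atomFormula m (i + 1, t, j) : S.language.Formula (Fin m)) =
      .rel (⟨i, h⟩ : S.language.Relations t.length) fun q => varTerm (ht _ (t.get_mem q)) := by
  rw [atomFormula, dif_pos ⟨h, ht⟩]

theorem atomFormula_func {m i j : ℕ} {t : List ℕ} (h : S.symb i = some (Sum.inr t.length))
    (ht : ∀ x ∈ t, x < m) (hj : j < m) :
    (atomFormula m (i + 1, t, j) : S.language.Formula (Fin m)) =
      .equal (.func (⟨i, h⟩ : S.language.Functions t.length)
        fun q => varTerm (ht _ (t.get_mem q))) (varTerm hj) := by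
  rw [atomFormula, dif_neg (by simp [h]), dif_pos ⟨h, ht, hj⟩]

theorem atomFormula_of_none {m i j : ℕ} {t : List ℕ} (h : S.symb i = none) :
    (atomFormula m (i + 1, t, j) : S.language.Formula (Fin m)) = .falsum := by
  rw [atomFormula, dif_neg (by simp [h]), dif_neg (by simp [h])]

theorem isQF_atomFormula {m : ℕ} (ℓ : ℕ × List ℕ × ℕ) :
    (atomFormula m ℓ : S.language.Formula (Fin m)).IsQF := by
  obtain ⟨_ | i, t, j⟩ := ℓ
  · rw [atomFormula]
    split_ifs
    · exact .of_isAtomic (.equal _ _)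
    · exact .falsum
  · rw [atomFormula]
    split_ifs
    · exact .of_isAtomic (.rel _ _)
    · exact .of_isAtomic (.equal _ _)
    · exact .falsum

variable (S) in
/-- The Gödel number of an atomic formula. -/
def atomNumber : ℕ × List ℕ × ℕ → ℕ
  -- A variable is a left summand of `Fin m ⊕ Fin 0`, and `Sum.inl` doubles codes; hence the factors
  -- `2`.
  | (0, t, j) => Nat.pair 1 (Nat.pair (Nat.pair 0 (2 * t.headI)) (Nat.pair 0 (2 * j)))
  | (i + 1, t, j) => (S.symb i).elim (Nat.pair 0 0) (Sum.elim
      (fun _ => Nat.pair 2 (Nat.pair i (Encodable.encode (t.map fun x => Nat.pair 0 (2 * x)))))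
      (fun _ => Nat.pair 1 (Nat.pair (Nat.pair 1 (Nat.pair i
        (Encodable.encode (t.map fun x => Nat.pair 0 (2 * x))))) (Nat.pair 0 (2 * j)))))

theorem termNumber_varTerm {m x : ℕ} (hx : x < m) :
    termNumber (varTerm hx : S.language.Term (Fin m ⊕ Fin 0)) = Nat.pair 0 (2 * x) := by
  simp only [varTerm, termNumber, Encodable.encode_inl]
  rfl

/-- Membership in `S.atoms m` is essential: `atomFormula` turns descriptions out of range into `⊥`,
while `atomNumber` does not check them. -/
theorem formulaNumber_atomFormula {m : ℕ} {ℓ : ℕ × List ℕ × ℕ} (hℓ : ℓ ∈ S.atoms m) :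
    formulaNumber (atomFormula m ℓ : S.language.Formula (Fin m)) = S.atomNumber ℓ := by
  obtain ⟨i, t, j⟩ := ℓ
  obtain ⟨hi, hl, ht, hj⟩ := S.mem_atoms.mp hℓ
  have hmap : (List.ofFn fun q : Fin t.length => Nat.pair 0 (2 * t.get q)) =
      t.map fun x => Nat.pair 0 (2 * x) := by
    conv_rhs => rw [← List.ofFn_get t, List.map_ofFn]
    rfl
  obtain _ | i := i
  · obtain ⟨x, rfl⟩ := List.length_eq_one_iff.mp hl
    have hx : x < m := by simpa using ht
    rw [atomFormula_equal hx hj]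
    simp [formulaNumber, termNumber_varTerm, atomNumber]
  · rcases hs : S.symb i with _ | k | k
    · rw [atomFormula_of_none hs]
      simp [atomNumber, hs, formulaNumber]
    · have hk : k = t.length := by simp [hl, argCount, hs]
      rw [hk] at hs
      rw [atomFormula_rel hs ht]
      simp [formulaNumber, termNumber_varTerm, atomNumber, hs, ← hmap]
    · have hk : k = t.length := by simp [hl, argCount, hs]
      rw [hk] at hs
      rw [atomFormula_func hs ht hj]
      simp [formulaNumber, termNumber, termNumber_varTerm, atomNumber, hs, ← hmap]

theorem computable_atomNumber : Computable S.atomNumber := by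
  have hvars : Primrec fun t : List ℕ =>
      Encodable.encode (t.map fun x => Nat.pair 0 (2 * x)) :=
    Primrec.encode.comp (Primrec.list_map Primrec.id (Primrec₂.natPair.comp (Primrec.const 0)
      (Primrec.nat_mul.comp (Primrec.const 2) Primrec.snd)))
  have hvar {α : Type} [Primcodable α] {f : α → ℕ} (hf : Primrec f) :
      Primrec fun a => Nat.pair 0 (2 * f a) :=
    Primrec₂.natPair.comp (Primrec.const 0) (Primrec.nat_mul.comp (Primrec.const 2) hf)
  refine (Computable.nat_casesOn (f := fun ℓ : ℕ × List ℕ × ℕ => ℓ.1)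
    (g := fun ℓ => Nat.pair 1 (Nat.pair (Nat.pair 0 (2 * ℓ.2.1.headI)) (Nat.pair 0 (2 * ℓ.2.2))))
    (h := fun ℓ i => Option.casesOn (motive := fun _ => ℕ) (S.symb i) (Nat.pair 0 0) fun s =>
      Sum.casesOn (motive := fun _ => ℕ) s
      (fun _ => Nat.pair 2 (Nat.pair i
        (Encodable.encode (ℓ.2.1.map fun x => Nat.pair 0 (2 * x)))))
      (fun _ => Nat.pair 1 (Nat.pair (Nat.pair 1 (Nat.pair i
        (Encodable.encode (ℓ.2.1.map fun x => Nat.pair 0 (2 * x))))) (Nat.pair 0 (2 * ℓ.2.2)))))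
    Computable.fst ?_ ?_).of_eq fun ℓ => ?_
  · exact (Primrec₂.natPair.comp (Primrec.const 1) (Primrec₂.natPair.comp
      (hvar (Primrec.list_headI.comp (Primrec.fst.comp Primrec.snd)))
      (hvar (Primrec.snd.comp Primrec.snd)))).to_comp
  · refine Computable.option_casesOn (S.computable.comp Computable.snd) (Computable.const _) ?_
    refine Computable.sumCasesOn Computable.snd ?_ ?_
    · refine Primrec.to_comp (f := fun x : ((((ℕ × List ℕ × ℕ) × ℕ) × (ℕ ⊕ ℕ)) × ℕ) => _) ?_
      exact Primrec₂.natPair.comp (Primrec.const 2) (Primrec₂.natPair.comp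
        (Primrec.snd.comp (Primrec.fst.comp Primrec.fst)) (hvars.comp (Primrec.fst.comp
          (Primrec.snd.comp (Primrec.fst.comp (Primrec.fst.comp Primrec.fst))))))
    · refine Primrec.to_comp (f := fun x : ((((ℕ × List ℕ × ℕ) × ℕ) × (ℕ ⊕ ℕ)) × ℕ) => _) ?_
      exact Primrec₂.natPair.comp (Primrec.const 1) (Primrec₂.natPair.comp
        (Primrec₂.natPair.comp (Primrec.const 1) (Primrec₂.natPair.comp
        (Primrec.snd.comp (Primrec.fst.comp Primrec.fst)) (hvars.comp (Primrec.fst.comp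
          (Primrec.snd.comp (Primrec.fst.comp (Primrec.fst.comp Primrec.fst)))))))
        (hvar (Primrec.snd.comp (Primrec.snd.comp (Primrec.fst.comp
          (Primrec.fst.comp Primrec.fst))))))
  · obtain ⟨_ | i, t, j⟩ := ℓ
    · rfl
    · simp only [atomNumber]
      rcases S.symb i with _ | _ | _ <;> rfl

/-- The tuple `v` satisfies the atomic formula with description `ℓ`. -/
def AtomHolds {M : Type} (A : S.language.Structure M) {m : ℕ} (v : Fin m → M)
    (ℓ : ℕ × List ℕ × ℕ) : Prop :=
  @Formula.Realize S.language M A _ (atomFormula m ℓ) v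

theorem atomHolds_equal {M : Type} (A : S.language.Structure M) {m : ℕ} (v : Fin m → M)
    {x j : ℕ} (hx : x < m) (hj : j < m) : AtomHolds A v (0, [x], j) ↔ v ⟨x, hx⟩ = v ⟨j, hj⟩ := by
  rw [AtomHolds, atomFormula_equal hx hj]
  rfl

theorem atomHolds_rel {M : Type} (A : S.language.Structure M) {m : ℕ} (v : Fin m → M) {k : ℕ}
    (r : S.language.Relations k) {t : List ℕ} (hk : t.length = k) (ht : ∀ x ∈ t, x < m) (j : ℕ) :
    AtomHolds A v (r.1 + 1, t, j) ↔
      A.RelMap r fun q => v ⟨t.get (Fin.cast hk.symm q), ht _ (t.get_mem _)⟩ := by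
  subst hk
  rw [AtomHolds, atomFormula_rel r.2 ht]
  rfl

theorem atomHolds_func {M : Type} (A : S.language.Structure M) {m : ℕ} (v : Fin m → M) {k : ℕ}
    (f : S.language.Functions k) {t : List ℕ} (hk : t.length = k) (ht : ∀ x ∈ t, x < m) {j : ℕ}
    (hj : j < m) : AtomHolds A v (f.1 + 1, t, j) ↔
      A.funMap f (fun q => v ⟨t.get (Fin.cast hk.symm q), ht _ (t.get_mem _)⟩) = v ⟨j, hj⟩ := by
  subst hk
  rw [AtomHolds, atomFormula_func f.2 ht hj]
  rfl

theorem not_atomHolds_of_none {M : Type} (A : S.language.Structure M) {m : ℕ} (v : Fin m → M)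
    {i j : ℕ} {t : List ℕ} (h : S.symb i = none) : ¬ AtomHolds A v (i + 1, t, j) := by
  rw [AtomHolds, atomFormula_of_none h]
  exact id

theorem sameAtomic_of_atoms {M N : Type} (A : S.language.Structure M) (B : S.language.Structure N)
    {m : ℕ} (a : Fin m → M) (b : Fin m → N)
    (h : ∀ ℓ ∈ S.atoms m, (AtomHolds A a ℓ ↔ AtomHolds B b ℓ)) : SameAtomic S A B a b := by
  have hlt {k : ℕ} (t : Fin k → Fin m) : ∀ x ∈ List.ofFn fun q => (t q : ℕ), x < m := by
    simp only [List.mem_ofFn]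
    rintro _ ⟨q, rfl⟩
    exact (t q).2
  refine ⟨fun i j => ?_, fun k r hr t => ?_, fun k f hf t j => ?_⟩
  · have := h (0, [(i : ℕ)], j) (S.mem_atoms.mpr ⟨by simp, rfl, by simp, j.2⟩)
    rwa [atomHolds_equal A a i.2 j.2, atomHolds_equal B b i.2 j.2] at this
  -- The last entry of the description plays no role for a relation but must be below `m`; `r.1` is
  -- such a number by `hr`.
  · have := h (r.1 + 1, List.ofFn fun q => (t q : ℕ), r.1)
      (S.mem_atoms.mpr ⟨hr, by simp [argCount, r.2], hlt t, hr⟩)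
    rw [atomHolds_rel A a r (by simp) (hlt t), atomHolds_rel B b r (by simp) (hlt t)] at this
    simpa using this
  · have := h (f.1 + 1, List.ofFn fun q => (t q : ℕ), j)
      (S.mem_atoms.mpr ⟨hf, by simp [argCount, f.2], hlt t, j.2⟩)
    rw [atomHolds_func A a f (by simp) (hlt t) j.2,
      atomHolds_func B b f (by simp) (hlt t) j.2] at this
    simpa using this

end CompSignature

/-- Satisfaction of atomic formulas in a computable structure is computable. -/
theorem IsComputableStructure.exists_atomHolds {S : CompSignature} {A : S.language.Structure ℕ}
    (hA : IsComputableStructure S A) :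
    ∃ q : List ℕ → ℕ × List ℕ × ℕ → Bool, Computable₂ q ∧
      ∀ (m : ℕ) (v : Fin m → ℕ), ∀ ℓ ∈ S.atoms m,
        (q (List.ofFn v) ℓ = true ↔ CompSignature.AtomHolds A v ℓ) := by
  obtain ⟨⟨F, hF, hFA⟩, R, hR, hRA⟩ := hA
  refine ⟨fun b ℓ => Nat.casesOn (motive := fun _ => Bool) ℓ.1
    (decide (b.getD ℓ.2.1.headI 0 = b.getD ℓ.2.2 0)) fun i =>
      Option.casesOn (motive := fun _ => Bool) (S.symb i) false fun s =>
      Sum.casesOn (motive := fun _ => Bool) s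
      (fun _ => R (i, ℓ.2.1.map fun x => b.getD x 0))
      (fun _ => decide (F (i, ℓ.2.1.map fun x => b.getD x 0) = b.getD ℓ.2.2 0)), ?_, ?_⟩
  · have hget : Primrec₂ fun (b : List ℕ) (x : ℕ) => b.getD x 0 := Primrec.list_getD 0
    have heq : Computable₂ fun x y : ℕ => decide (x = y) := (Primrec.eq (α := ℕ)).decide.to_comp
    refine Computable.nat_casesOn (Computable.fst.comp Computable.snd) ?_ ?_
    · exact (Primrec.eq.decide.comp
        (hget.comp Primrec.fst (Primrec.list_headI.comp
          (Primrec.fst.comp (Primrec.snd.comp Primrec.snd))))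
        (hget.comp Primrec.fst (Primrec.snd.comp (Primrec.snd.comp Primrec.snd)))).to_comp
    · refine Computable.option_casesOn (S.computable.comp Computable.snd) (Computable.const _) ?_
      let τ : Type := ((List ℕ × ℕ × List ℕ × ℕ) × ℕ) × (ℕ ⊕ ℕ)
      have ht : Primrec fun x : τ => x.1.1.2.2.1 := Primrec.fst.comp (Primrec.snd.comp
        (Primrec.snd.comp (Primrec.fst.comp Primrec.fst)))
      have hb : Primrec fun x : τ => x.1.1.1 :=
        Primrec.fst.comp (Primrec.fst.comp Primrec.fst)
      have hi : Primrec fun x : τ => x.1.2 := Primrec.snd.comp Primrec.fst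
      have hg : Primrec₂ fun (x : τ) (y : ℕ) => x.1.1.1.getD y 0 := by
        have hb' : Primrec fun p : τ × ℕ => p.1.1.1.1 := hb.comp Primrec.fst
        have h := hget.comp hb' Primrec.snd
        exact h
      have hmap : Primrec fun x : τ => x.1.1.2.2.1.map fun y => x.1.1.1.getD y 0 :=
        Primrec.list_map ht hg
      have hargs : Computable fun x : τ => (x.1.2, x.1.1.2.2.1.map fun y => x.1.1.1.getD y 0) :=
        (hi.pair hmap).to_comp
      refine Computable.sumCasesOn Computable.snd ((hR.comp hargs).comp Computable.fst) ?_
      have hj : Primrec fun x : τ => x.1.1.2.2.2 := Primrec.snd.comp (Primrec.snd.comp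
        (Primrec.snd.comp (Primrec.fst.comp Primrec.fst)))
      have hval : Computable fun x : τ => x.1.1.1.getD x.1.1.2.2.2 0 := (hget.comp hb hj).to_comp
      exact (heq.comp (hF.comp hargs) hval).comp Computable.fst
  · rintro m v ⟨i, t, j⟩ hℓ
    obtain ⟨hi, hl, ht, hj⟩ := S.mem_atoms.mp hℓ
    have hget {x : ℕ} (hx : x < m) : (List.ofFn v).getD x 0 = v ⟨x, hx⟩ := by
      simp [List.getD, hx]
    have hmap {k : ℕ} (hk : t.length = k) : (t.map fun x => (List.ofFn v).getD x 0) =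
        List.ofFn fun q => v ⟨t.get (Fin.cast hk.symm q), ht _ (t.get_mem _)⟩ := by
      subst hk
      conv_lhs => rw [← List.ofFn_get t, List.map_ofFn]
      exact congrArg _ (funext fun q => hget _)
    obtain _ | i := i
    · obtain ⟨x, rfl⟩ := List.length_eq_one_iff.mp hl
      have hx : x < m := by simpa using ht
      rw [CompSignature.atomHolds_equal A v hx hj]
      simp only [List.headI_cons, hget hx, hget hj]
      exact decide_eq_true_iff
    · change Option.casesOn (motive := fun _ => Bool) (S.symb i) _ _ = true ↔ _
      rcases hs : S.symb i with _ | k | k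
      · exact iff_of_false Bool.false_ne_true (CompSignature.not_atomHolds_of_none A v hs)
      · have hk : t.length = k := by simp [hl, CompSignature.argCount, hs]
        simp only [hmap hk]
        rw [CompSignature.atomHolds_rel A v (⟨i, hs⟩ : S.language.Relations k) hk ht]
        exact hRA k ⟨i, hs⟩ _
      · have hk : t.length = k := by simp [hl, CompSignature.argCount, hs]
        simp only [hmap hk, hget hj, decide_eq_true_eq]
        rw [CompSignature.atomHolds_func A v (⟨i, hs⟩ : S.language.Functions k) hk ht hj,
          ← hFA k ⟨i, hs⟩ _]

namespace CompSignature

open FirstOrder FirstOrder.Language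

variable {S : CompSignature}

/-- The formula saying that some atomic formula with description in `L` does not have the truth
value prescribed by `q`. -/
noncomputable def disagreement (m : ℕ) (q : ℕ × List ℕ × ℕ → Bool) :
    List (ℕ × List ℕ × ℕ) → S.language.Formula (Fin m)
  | [] => .falsum
  -- A chain of implications ending in `⊥` negates a conjunction of literals, and its Gödel number
  -- is a right fold.
  | ℓ :: L =>
    .imp (cond (q ℓ) (atomFormula m ℓ) (.imp (atomFormula m ℓ) .falsum)) (disagreement m q L)

theorem isQF_disagreement (m : ℕ) (q : ℕ × List ℕ × ℕ → Bool) (L : List (ℕ × List ℕ × ℕ)) :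
    (disagreement m q L : S.language.Formula (Fin m)).IsQF := by
  induction L with
  | nil => exact .falsum
  | cons ℓ L ih =>
    refine .imp ?_ ih
    cases q ℓ
    · exact .imp (isQF_atomFormula ℓ) .falsum
    · exact isQF_atomFormula ℓ

theorem realize_disagreement {M : Type} (A : S.language.Structure M) {m : ℕ} (v : Fin m → M)
    (q : ℕ × List ℕ × ℕ → Bool) (L : List (ℕ × List ℕ × ℕ)) :
    @Formula.Realize S.language M A _ (disagreement m q L) v ↔
      ¬ ∀ ℓ ∈ L, (q ℓ = true ↔ AtomHolds A v ℓ) := by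
  induction L with
  | nil => simpa using! id
  | cons ℓ L ih =>
    have h : @Formula.Realize S.language M A _
        (cond (q ℓ) (atomFormula m ℓ) (.imp (atomFormula m ℓ) .falsum)) v ↔
        (q ℓ = true ↔ AtomHolds A v ℓ) := by
      cases q ℓ
      · exact ⟨fun h => ⟨nofun, fun h' => (h h').elim⟩, fun h h' => nomatch h.mpr h'⟩
      · exact ⟨fun h => ⟨fun _ => h, fun _ => rfl⟩, fun h => h.mp rfl⟩
    rw [List.forall_mem_cons, ← h, not_and, ← ih]
    rfl

variable (S) in
/-- The Gödel number of a disagreement formula. -/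
def disagreementNumber (q : ℕ × List ℕ × ℕ → Bool) (L : List (ℕ × List ℕ × ℕ)) : ℕ :=
  L.foldr (fun ℓ n => Nat.pair 3 (Nat.pair (cond (q ℓ) (S.atomNumber ℓ)
    (Nat.pair 3 (Nat.pair (S.atomNumber ℓ) (Nat.pair 0 0)))) n)) (Nat.pair 0 0)

theorem formulaNumber_disagreement {m : ℕ} (q : ℕ × List ℕ × ℕ → Bool)
    {L : List (ℕ × List ℕ × ℕ)} (hL : ∀ ℓ ∈ L, ℓ ∈ S.atoms m) :
    formulaNumber (disagreement m q L : S.language.Formula (Fin m)) =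
      S.disagreementNumber q L := by
  induction L with
  | nil => rfl
  | cons ℓ L ih =>
    obtain ⟨h, hL⟩ := List.forall_mem_cons.mp hL
    simp only [disagreement, formulaNumber, ih hL, disagreementNumber, List.foldr_cons]
    cases q ℓ <;> simp [formulaNumber, formulaNumber_atomFormula h]

theorem computable_disagreementNumber {α : Type} [Primcodable α]
    {q : α → ℕ × List ℕ × ℕ → Bool} (hq : Computable₂ q) {L : α → List (ℕ × List ℕ × ℕ)}
    (hL : Computable L) : Computable fun a => S.disagreementNumber (q a) (L a) := by
  have hpair : Computable₂ Nat.pair := Primrec₂.natPair.to_comp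
  refine Computable.list_foldr (h := fun a (p : (ℕ × List ℕ × ℕ) × ℕ) => Nat.pair 3 (Nat.pair
    (cond (q a p.1) (S.atomNumber p.1)
      (Nat.pair 3 (Nat.pair (S.atomNumber p.1) (Nat.pair 0 0)))) p.2)) hL (Computable.const _) ?_
  have hn : Computable fun x : α × (ℕ × List ℕ × ℕ) × ℕ => S.atomNumber x.2.1 :=
    computable_atomNumber.comp (Computable.fst.comp Computable.snd)
  exact hpair.comp (Computable.const 3) (hpair.comp (Computable.cond
    (hq.comp Computable.fst (Computable.fst.comp Computable.snd)) hn
    (hpair.comp (Computable.const 3) (hpair.comp hn (Computable.const _))))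
    (Computable.snd.comp Computable.snd))

end CompSignature

/-! ### Negations and disjunctions of infinitary formulas -/

/-- The sort of the negation of a formula. -/
def FormulaSort.dual : FormulaSort → FormulaSort
  | sigma => pi
  | pi => sigma

namespace InfFormula

open FirstOrder FirstOrder.Language

variable {S : CompSignature}

/-- The negation of a formula, in normal form. -/
def neg : {p : FormulaSort} → {n m : ℕ} → InfFormula S p n m → InfFormula S p.dual n m
  | _, _, _, qf θ hθ => qf (.imp θ .falsum) (.imp hθ .falsum)
  | _, _, _, disj I len ψ => conj I len fun i => neg (ψ i)
  | _, _, _, conj I len ψ => disj I len fun i => neg (ψ i)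

theorem realize_neg {M : Type} (A : S.language.Structure M) {p : FormulaSort} {n m : ℕ}
    (φ : InfFormula S p n m) (v : Fin m → M) : φ.neg.Realize A v ↔ ¬ φ.Realize A v := by
  induction φ with
  | qf θ hθ => exact Iff.rfl
  | disj I len ψ ih =>
    refine Iff.trans (forall₂_congr fun i w => ih i _) ?_
    simp [Realize]
  | conj I len ψ ih =>
    refine Iff.trans (exists_congr fun i => exists_congr fun w => ih i _) ?_
    simp [Realize]

/-- Negation keeps the shape of the tree and all tuple lengths. The leaves are exactly the nodes of
length `n`, so only their Gödel numbers change. -/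
theorem tree_neg {p : FormulaSort} {n m : ℕ} (φ : InfFormula S p n m) (k : ℕ) (σ : List ℕ) :
    φ.neg.tree k σ = (φ.tree k σ).map fun y =>
      if σ.length = n then (y.1, Nat.pair 3 (Nat.pair y.2 (Nat.pair 0 0))) else y := by
  induction φ generalizing k σ with
  | qf θ hθ => cases σ <;> simp [neg, tree, formulaNumber]
  | disj I len ψ ih =>
    rcases σ with _ | ⟨i, σ⟩
    · simp [neg, tree]
    · by_cases h : i ∈ I
      · simp only [neg, tree, dif_pos h]
        exact (ih ⟨i, h⟩ _ _).trans (by simp)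
      · simp [neg, tree, h]
  | conj I len ψ ih =>
    rcases σ with _ | ⟨i, σ⟩
    · simp [neg, tree]
    · by_cases h : i ∈ I
      · simp only [neg, tree, dif_pos h]
        exact (ih ⟨i, h⟩ _ _).trans (by simp)
      · simp [neg, tree, h]

/-- The negation of a `Σₙ` formula, as a `Πₙ` formula. -/
def negSigma {n m : ℕ} (φ : InfFormula S .sigma n m) : InfFormula S .pi n m :=
  φ.neg

theorem realize_negSigma {M : Type} (A : S.language.Structure M) {n m : ℕ}
    (φ : InfFormula S .sigma n m) (v : Fin m → M) : φ.negSigma.Realize A v ↔ ¬ φ.Realize A v :=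
  φ.realize_neg A v

/-- The index set of the disjunction of two disjunctions with index sets `I` and `J`. -/
def orIndex (I J : Set ℕ) : Set ℕ :=
  {i | (i % 2 = 0 ∧ i / 2 ∈ I) ∨ (i % 2 = 1 ∧ i / 2 ∈ J)}

theorem half_mem_left {I J : Set ℕ} (i : orIndex I J) (h : i.1 % 2 = 0) : i.1 / 2 ∈ I := by
  rcases i.2 with h' | h'
  · exact h'.2
  · omega

theorem half_mem_right {I J : Set ℕ} (i : orIndex I J) (h : ¬ i.1 % 2 = 0) : i.1 / 2 ∈ J := by
  rcases i.2 with h' | h'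
  · omega
  · exact h'.2

/-- The immediate subformulas of the disjunction of two disjunctions. -/
def orChild {I J : Set ℕ} {β : Type} (f : I → β) (g : J → β) (i : orIndex I J) : β :=
  if h : i.1 % 2 = 0 then f ⟨i.1 / 2, half_mem_left i h⟩ else g ⟨i.1 / 2, half_mem_right i h⟩

theorem orChild_left {I J : Set ℕ} {β : Type} (f : I → β) (g : J → β) (i : orIndex I J)
    (h : i.1 % 2 = 0) : orChild f g i = f ⟨i.1 / 2, half_mem_left i h⟩ :=
  dif_pos h

theorem orChild_right {I J : Set ℕ} {β : Type} (f : I → β) (g : J → β) (i : orIndex I J)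
    (h : ¬ i.1 % 2 = 0) : orChild f g i = g ⟨i.1 / 2, half_mem_right i h⟩ :=
  dif_neg h

theorem exists_orChild {I J : Set ℕ} {β : Type} (f : I → β) (g : J → β) (P : β → Prop) :
    (∃ i, P (orChild f g i)) ↔ (∃ i, P (f i)) ∨ ∃ j, P (g j) := by
  constructor
  · rintro ⟨i, hi⟩
    unfold orChild at hi
    split_ifs at hi
    · exact .inl ⟨_, hi⟩
    · exact .inr ⟨_, hi⟩
  · rintro (⟨⟨i, hi⟩, h⟩ | ⟨⟨j, hj⟩, h⟩)
    · have e : 2 * i / 2 = i := by omega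
      refine ⟨⟨2 * i, .inl ⟨by omega, e.symm ▸ hi⟩⟩, ?_⟩
      rw [orChild, dif_pos (by simp)]
      convert h
    · have e : (2 * j + 1) / 2 = j := by omega
      refine ⟨⟨2 * j + 1, .inr ⟨by omega, e.symm ▸ hj⟩⟩, ?_⟩
      rw [orChild, dif_neg (by simp)]
      convert h

/-- The disjunction of two `Σₙ` formulas. -/
def or : {n m : ℕ} → InfFormula S .sigma n m → InfFormula S .sigma n m → InfFormula S .sigma n m
  | _, _, qf θ hθ, qf χ hχ => qf (.imp (.imp θ .falsum) χ) (.imp (.imp hθ .falsum) hχ)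
  | _, m, @disj _ n _ I len φ, disj J len' ψ =>
    -- The length and the subformula are chosen together, as an element of a sigma type, because the
    -- type of the subformula depends on the length.
    disj (orIndex I J)
      (fun i => (orChild (β := Σ l, InfFormula S .pi n (m + l)) (fun i => ⟨len i, φ i⟩)
        (fun j => ⟨len' j, ψ j⟩) i).1)
      (fun i => (orChild (β := Σ l, InfFormula S .pi n (m + l)) (fun i => ⟨len i, φ i⟩)
        (fun j => ⟨len' j, ψ j⟩) i).2)

theorem realize_or {M : Type} (A : S.language.Structure M) {n m : ℕ}
    (φ ψ : InfFormula S .sigma n m) (v : Fin m → M) :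
    (φ.or ψ).Realize A v ↔ φ.Realize A v ∨ ψ.Realize A v := by
  cases φ with
  | qf θ hθ =>
    cases ψ with
    | qf χ hχ =>
      exact (or_iff_not_imp_left (a := @Formula.Realize S.language M A _ θ v)
        (b := @Formula.Realize S.language M A _ χ v)).symm
  | disj I len φ =>
    cases ψ with
    | disj J len' ψ =>
      exact exists_orChild _ _ fun x : Σ l, InfFormula S .pi _ (m + l) =>
        ∃ w : Fin x.1 → M, x.2.Realize A (Fin.append v w)

theorem tree_or_zero {m : ℕ} (φ ψ : InfFormula S .sigma 0 m) (k : ℕ) (σ : List ℕ) :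
    (φ.or ψ).tree k σ = (φ.tree k σ).bind fun y => (ψ.tree k σ).map fun z =>
      (y.1, Nat.pair 3 (Nat.pair (Nat.pair 3 (Nat.pair y.2 (Nat.pair 0 0))) z.2)) := by
  cases φ
  cases ψ
  cases σ <;> simp [or, tree, formulaNumber]

/-- Even indices address `φ` and odd ones `ψ`. The root is tested first, since `headI` of the empty
list is `0` and would look like an even index. -/
theorem tree_or_succ {n m : ℕ} (φ ψ : InfFormula S .sigma (n + 1) m) (k : ℕ) (σ : List ℕ) :
    (φ.or ψ).tree k σ = if σ = [] then some (k, 0) else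
      if σ.headI % 2 = 0 then φ.tree k (σ.headI / 2 :: σ.tail)
      else ψ.tree k (σ.headI / 2 :: σ.tail) := by
  cases φ with
  | disj I len φ =>
  cases ψ with
  | disj J len' ψ =>
    rcases σ with _ | ⟨i, σ⟩
    · simp [or, tree]
    · rw [if_neg (List.cons_ne_nil i σ), List.headI_cons, List.tail_cons]
      let β := Σ l, InfFormula S .pi n (m + l)
      let f : I → β := fun i => ⟨len i, φ i⟩
      let g : J → β := fun j => ⟨len' j, ψ j⟩
      simp only [or, tree]
      split_ifs with h' h hi hi h hi hi
      · exact congrArg (fun x : β => x.2.tree x.1 σ) (orChild_left f g ⟨i, h'⟩ h)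
      · exact absurd (half_mem_left ⟨i, h'⟩ h) hi
      · exact congrArg (fun x : β => x.2.tree x.1 σ) (orChild_right f g ⟨i, h'⟩ h)
      · exact absurd (half_mem_right ⟨i, h'⟩ h) hi
      · exact absurd (Or.inl ⟨h, hi⟩) h'
      · rfl
      · exact absurd (Or.inr ⟨by omega, hi⟩) h'
      · rfl

end InfFormula

/-! ### Uniformly computable families of formulas -/

/-- A family of formulas, depending on the number `m` of free variables and on a parameter, is
uniformly `X`-computable if its syntax trees are `X`-computable uniformly in `m` and the
parameter. -/
def UniformlyIn (X : Set ℕ) {S : CompSignature} {p : FormulaSort} {n : ℕ} {α : Type}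
    [Primcodable α] (Φ : (m : ℕ) → α → InfFormula S p n m) : Prop :=
  ComputableIn {charOracle X} fun x : (ℕ × α) × ℕ × List ℕ =>
    (Φ x.1.1 x.1.2).tree x.2.1 x.2.2

namespace UniformlyIn

open FirstOrder FirstOrder.Language

variable {X Y : Set ℕ} {S : CompSignature} {p : FormulaSort} {n : ℕ} {α β : Type}
  [Primcodable α] [Primcodable β]

theorem mono (hXY : TuringReducible (charOracle X) (charOracle Y))
    {Φ : (m : ℕ) → α → InfFormula S p n m} (hΦ : UniformlyIn X Φ) : UniformlyIn Y Φ :=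
  RecursiveIn.subst hΦ (by simpa using hXY)

theorem negSigma {Φ : (m : ℕ) → α → InfFormula S .sigma n m} (hΦ : UniformlyIn X Φ) :
    UniformlyIn X fun m a => (Φ m a).negSigma := by
  have h : Primrec fun x : ((ℕ × α) × ℕ × List ℕ) × Option (ℕ × ℕ) => x.2.map fun y =>
      if x.1.2.2.length = n then (y.1, Nat.pair 3 (Nat.pair y.2 (Nat.pair 0 0))) else y := by
    refine Primrec.option_map Primrec.snd (Primrec.ite (Primrec.eq.comp
      (Primrec.list_length.comp (Primrec.snd.comp (Primrec.snd.comp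
        (Primrec.fst.comp Primrec.fst)))) (Primrec.const n)) ?_ Primrec.snd)
    exact (Primrec.fst.comp Primrec.snd).pair (Primrec₂.natPair.comp (Primrec.const 3)
      (Primrec₂.natPair.comp (Primrec.snd.comp Primrec.snd) (Primrec.const _)))
  exact (h.computableIn.comp (ComputableIn.id.pair hΦ)).of_eq fun x =>
    (InfFormula.tree_neg _ _ _).symm

theorem or {Φ Ψ : (m : ℕ) → α → InfFormula S .sigma n m} (hΦ : UniformlyIn X Φ)
    (hΨ : UniformlyIn X Ψ) : UniformlyIn X fun m a => (Φ m a).or (Ψ m a) := by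
  cases n with
  | zero =>
    have h : Primrec fun x : Option (ℕ × ℕ) × Option (ℕ × ℕ) => x.1.bind fun y => x.2.map fun z =>
        (y.1, Nat.pair 3 (Nat.pair (Nat.pair 3 (Nat.pair y.2 (Nat.pair 0 0))) z.2)) := by
      refine Primrec.option_bind Primrec.fst (Primrec.option_map
        (Primrec.snd.comp Primrec.fst) ?_)
      exact (Primrec.fst.comp (Primrec.snd.comp Primrec.fst)).pair
        (Primrec₂.natPair.comp (Primrec.const 3) (Primrec₂.natPair.comp
          (Primrec₂.natPair.comp (Primrec.const 3) (Primrec₂.natPair.comp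
            (Primrec.snd.comp (Primrec.snd.comp Primrec.fst)) (Primrec.const _)))
          (Primrec.snd.comp Primrec.snd)))
    exact (h.computableIn.comp (hΦ.pair hΨ)).of_eq fun x =>
      (InfFormula.tree_or_zero _ _ _ _).symm
  | succ n =>
    have hσ : Primrec fun x : (ℕ × α) × ℕ × List ℕ => x.2.2 := Primrec.snd.comp Primrec.snd
    have hhead := Primrec.list_headI.comp hσ
    have hg : Primrec fun x : (ℕ × α) × ℕ × List ℕ =>
        (x.1, x.2.1, x.2.2.headI / 2 :: x.2.2.tail) :=
      Primrec.fst.pair ((Primrec.fst.comp Primrec.snd).pair (Primrec.list_cons.comp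
        (Primrec.nat_div.comp hhead (Primrec.const 2)) (Primrec.list_tail.comp hσ)))
    have h : Primrec fun x : ((ℕ × α) × ℕ × List ℕ) × Option (ℕ × ℕ) × Option (ℕ × ℕ) =>
        if x.1.2.2 = [] then some (x.1.2.1, 0) else
          if x.1.2.2.headI % 2 = 0 then x.2.1 else x.2.2 := by
      refine Primrec.ite (Primrec.eq.comp (hσ.comp Primrec.fst) (Primrec.const []))
        (Primrec.option_some.comp ((Primrec.fst.comp (Primrec.snd.comp Primrec.fst)).pair
          (Primrec.const 0))) (Primrec.ite (Primrec.eq.comp (Primrec.nat_mod.comp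
            (hhead.comp Primrec.fst) (Primrec.const 2)) (Primrec.const 0))
          (Primrec.fst.comp Primrec.snd) (Primrec.snd.comp Primrec.snd))
    exact (h.computableIn.comp (ComputableIn.id.pair ((ComputableIn.comp hΦ hg.computableIn).pair
      (ComputableIn.comp hΨ hg.computableIn)))).of_eq fun x =>
        (InfFormula.tree_or_succ _ _ _ _).symm

theorem qf {θ : (m : ℕ) → α → S.language.Formula (Fin m)} (hθ : ∀ m a, (θ m a).IsQF)
    {N : ℕ × α → ℕ} (hN : ComputableIn {charOracle X} N)
    (h : ∀ m a, formulaNumber (θ m a) = N (m, a)) :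
    UniformlyIn X fun m a => (InfFormula.qf (θ m a) (hθ m a) : InfFormula S p 0 m) := by
  have h' : Primrec fun x : ((ℕ × α) × ℕ × List ℕ) × ℕ =>
      if x.1.2.2 = [] then some (x.1.2.1, x.2) else none :=
    Primrec.ite (Primrec.eq.comp (Primrec.snd.comp (Primrec.snd.comp Primrec.fst))
      (Primrec.const [])) (Primrec.option_some.comp
        ((Primrec.fst.comp (Primrec.snd.comp Primrec.fst)).pair Primrec.snd)) (Primrec.const none)
  refine (h'.computableIn.comp (ComputableIn.id.pair (hN.comp ComputableIn.fst))).of_eq ?_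
  rintro ⟨⟨m, a⟩, k, _ | _⟩ <;> simp [InfFormula.tree, h]

/-- The subtree at index `i` is the tree of another member of the family `Φ`, with more free
variables, so one call to the trees of `Φ` yields the label. This is why uniformity in `m` is
demanded. -/
theorem disj {Φ : (m : ℕ) → β → InfFormula S .pi n m} (hΦ : UniformlyIn X Φ)
    {I : ℕ × α × ℕ → Bool} (hI : Computable I) {len : ℕ × α × ℕ → ℕ} (hlen : Computable len)
    {g : α × ℕ → β} (hg : Computable g) :
    UniformlyIn X fun m a => InfFormula.disj {i | I (m, a, i) = true}
      (fun i => len (m, a, i)) fun i => Φ (m + len (m, a, i)) (g (a, i)) := by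
  have harg : Computable fun x : (ℕ × α) × ℕ × List ℕ => (x.1.1, x.1.2, x.2.2.headI) :=
    (Computable.fst.comp Computable.fst).pair ((Computable.snd.comp Computable.fst).pair
      (Primrec.list_headI.to_comp.comp (Computable.snd.comp Computable.snd)))
  have hT : Computable fun x : (ℕ × α) × ℕ × List ℕ =>
      ((x.1.1 + len (x.1.1, x.1.2, x.2.2.headI), g (x.1.2, x.2.2.headI)),
        len (x.1.1, x.1.2, x.2.2.headI), x.2.2.tail) :=
    ((Primrec.nat_add.to_comp.comp (Computable.fst.comp Computable.fst) (hlen.comp harg)).pair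
      (hg.comp (Computable.snd.comp harg))).pair ((hlen.comp harg).pair
        (Primrec.list_tail.to_comp.comp (Computable.snd.comp Computable.snd)))
  have h : Computable fun x : ((ℕ × α) × ℕ × List ℕ) × Option (ℕ × ℕ) =>
      cond (decide (x.1.2.2 = [])) (some (x.1.2.1, 0))
        (cond (I (x.1.1.1, x.1.1.2, x.1.2.2.headI)) x.2 none) := by
    refine Computable.cond (Primrec.eq.decide.comp
      (Primrec.snd.comp (Primrec.snd.comp Primrec.fst)) (Primrec.const [])).to_comp ?_
      (Computable.cond ((hI.comp harg).comp Computable.fst) Computable.snd (Computable.const none))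
    exact (Primrec.option_some.comp ((Primrec.fst.comp (Primrec.snd.comp Primrec.fst)).pair
      (Primrec.const 0))).to_comp
  refine (h.computableIn.comp (ComputableIn.id.pair
    (ComputableIn.comp hΦ hT.computableIn))).of_eq ?_
  rintro ⟨⟨m, a⟩, k, _ | ⟨i, σ⟩⟩
  · simp [InfFormula.tree]
  · cases hi : I (m, a, i) <;> simp [InfFormula.tree, hi]

end UniformlyIn

open FirstOrder FirstOrder.Language in
/-- A `Σₖ(X)` predicate is expressed by a uniformly `X`-computable family of `Σₖ` formulas whose
truth values do not depend on the structure. -/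
theorem SigmaIn.exists_uniformlyIn (S : CompSignature) {X : Set ℕ} {k : ℕ} {α : Type}
    [Primcodable α] {r : α → Prop} (hr : SigmaIn X k r) :
    ∃ Φ : (m : ℕ) → α → InfFormula S .sigma k m, UniformlyIn X Φ ∧
      ∀ {M : Type} (A : S.language.Structure M) (m : ℕ) (a : α) (v : Fin m → M),
        (Φ m a).Realize A v ↔ r a := by
  induction k generalizing α with
  | zero =>
    obtain ⟨q, hq, h⟩ := hr
    have hθ (m : ℕ) (a : α) : BoundedFormula.IsQF (L := S.language) (α := Fin m) (n := 0)
        (cond (q a) (.imp .falsum .falsum) .falsum) := by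
      cases q a
      · exact .falsum
      · exact .imp .falsum .falsum
    refine ⟨fun m a => .qf _ (hθ m a),
      UniformlyIn.qf (N := fun x => cond (q x.2) (Nat.pair 3 (Nat.pair (Nat.pair 0 0)
        (Nat.pair 0 0))) (Nat.pair 0 0)) hθ ?_ fun m a => ?_, fun A m a v => ?_⟩
    · exact ComputableIn.comp (f := fun b : Bool => cond b _ _)
        (Primrec.dom_finite _).computableIn (hq.comp ComputableIn.snd)
    · cases q a <;> rfl
    · rw [← h]
      simp only [InfFormula.Realize]
      cases q a
      · exact iff_of_false id Bool.false_ne_true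
      · exact iff_of_true id rfl
  | succ k ih =>
    obtain ⟨s, hs, h⟩ := hr
    obtain ⟨Φ, hΦ, hΦs⟩ := ih hs
    -- The quantifier over numbers becomes a countable disjunction of negated formulas, each with an
    -- empty tuple of quantified variables.
    refine ⟨_, UniformlyIn.disj (α := α) hΦ.negSigma (Computable.const true) (Computable.const 0)
      Computable.id, fun A m a v => ?_⟩
    simp only [InfFormula.Realize, h]
    constructor
    · rintro ⟨i, w, hw⟩
      exact ⟨i, by rwa [InfFormula.realize_negSigma, hΦs] at hw⟩
    · rintro ⟨i, hi⟩
      refine ⟨⟨i, rfl⟩, Fin.elim0, ?_⟩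
      rwa [InfFormula.realize_negSigma, hΦs]

/-! ### Back-and-forth relations between lists -/

section BackAndForth

open FirstOrder FirstOrder.Language CompSignature

variable {S : CompSignature}

/-- The relation `(A, a) ≤ₙ (B, b)` for tuples given as lists. -/
def ListBackForth (S : CompSignature) : ℕ → (A B : S.language.Structure ℕ) →
    List ℕ → List ℕ → Prop
  | 0, A, B, a, b => ∃ (m : ℕ) (v w : Fin m → ℕ), List.ofFn v = a ∧ List.ofFn w = b ∧
      ∀ ℓ ∈ S.atoms m, (AtomHolds A v ℓ ↔ AtomHolds B w ℓ)
  | n + 1, A, B, a, b => a.length = b.length ∧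
      ∀ b', ∃ a', ListBackForth S n B A (b ++ b') (a ++ a')

/-- `b` has an extension `b⁺` with `(A, a) ≤ₙ (B, b⁺)`. -/
def Extendible (S : CompSignature) (n : ℕ) (A B : S.language.Structure ℕ) (a b : List ℕ) : Prop :=
  ∃ u, ListBackForth S n A B a (b ++ u)

theorem ListBackForth.length_eq {n : ℕ} {A B : S.language.Structure ℕ} {a b : List ℕ}
    (h : ListBackForth S n A B a b) : a.length = b.length := by
  cases n with
  | zero => obtain ⟨m, v, w, rfl, rfl, -⟩ := h; simp
  | succ n => exact h.1

theorem List.exists_ofFn_eq {α : Type} {m : ℕ} {l : List α} (h : l.length = m) :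
    ∃ v : Fin m → α, List.ofFn v = l := by
  subst h
  exact ⟨l.get, List.ofFn_get l⟩

/-- The equality of lengths built into the list relation forces each answer, a priori a list of any
length, to be a tuple of the right length. -/
theorem ListBackForth.backForth {n : ℕ} {A B : S.language.Structure ℕ} {m : ℕ} {a b : Fin m → ℕ}
    (h : ListBackForth S n A B (List.ofFn a) (List.ofFn b)) : BackForth S n A B a b := by
  induction n generalizing A B m with
  | zero =>
    obtain ⟨m', v, w, hv, hw, h⟩ := h
    obtain rfl : m' = m := by simpa using congrArg List.length hv
    obtain rfl := List.ofFn_injective hv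
    obtain rfl := List.ofFn_injective hw
    exact sameAtomic_of_atoms A B v w h
  | succ n ih =>
    intro k b'
    obtain ⟨a', ha'⟩ := h.2 (List.ofFn b')
    obtain ⟨a', rfl⟩ := List.exists_ofFn_eq (m := k) (l := a') (by simpa using ha'.length_eq.symm)
    rw [← List.ofFn_fin_append, ← List.ofFn_fin_append] at ha'
    exact ⟨a', ih ha'⟩

theorem computable_listBackForth_zero {A B : S.language.Structure ℕ}
    (hA : IsComputableStructure S A) (hB : IsComputableStructure S B) :
    ∃ q : List ℕ × List ℕ → Bool, Computable q ∧
      ∀ x, q x = true ↔ ¬ ListBackForth S 0 A B x.1 x.2 := by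
  obtain ⟨qA, hqA, hA⟩ := hA.exists_atomHolds
  obtain ⟨qB, hqB, hB⟩ := hB.exists_atomHolds
  refine ⟨fun x => !(decide (x.1.length = x.2.length) &&
    (S.atoms x.1.length).all fun ℓ => decide (qA x.1 ℓ = qB x.2 ℓ)), ?_, ?_⟩
  · refine Primrec.not.to_comp.comp (Primrec.and.to_comp.comp ?_ (Computable.list_all ?_ ?_))
    · exact (Primrec.eq.decide.comp (Primrec.list_length.comp Primrec.fst)
        (Primrec.list_length.comp Primrec.snd)).to_comp
    · exact S.computable_atoms.comp (Computable.list_length.comp Computable.fst)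
    · exact (Primrec.eq (α := Bool)).decide.to_comp.comp
        (hqA.comp (Computable.fst.comp Computable.fst) Computable.snd)
        (hqB.comp (Computable.snd.comp Computable.fst) Computable.snd)
  · rintro ⟨a, b⟩
    rw [Bool.not_eq_true', ← Bool.not_eq_true, not_iff_not]
    simp only [Bool.and_eq_true, decide_eq_true_eq, List.all_eq_true]
    constructor
    · rintro ⟨hl, h⟩
      obtain ⟨v, hv⟩ := List.exists_ofFn_eq (rfl : a.length = a.length)
      obtain ⟨w, hw⟩ := List.exists_ofFn_eq hl.symm
      refine ⟨_, v, w, hv, hw, fun ℓ hℓ => ?_⟩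
      rw [← hA _ v ℓ hℓ, ← hB _ w ℓ hℓ, hv, hw, h ℓ hℓ]
    · rintro ⟨m, v, w, rfl, rfl, h⟩
      refine ⟨by simp, fun ℓ hℓ => ?_⟩
      rw [List.length_ofFn] at hℓ
      rw [Bool.eq_iff_iff, hA m v ℓ hℓ, hB m w ℓ hℓ, h ℓ hℓ]

theorem SigmaIn.extendible_of_not {n k : ℕ} {A B : S.language.Structure ℕ}
    (h : SigmaIn ∅ k fun x : List ℕ × List ℕ => ¬ ListBackForth S n A B x.1 x.2) :
    SigmaIn ∅ (k + 1) fun x : List ℕ × List ℕ => Extendible S n A B x.1 x.2 := by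
  have hf : Computable fun x : (List ℕ × List ℕ) × List ℕ => (x.1.1, x.1.2 ++ x.2) :=
    (Computable.fst.comp Computable.fst).pair
      (Computable.list_append.comp (Computable.snd.comp Computable.fst) Computable.snd)
  have := (h.comp hf).exists_not
  simp only [not_not] at this
  exact this

/-- Each level adds two quantifiers, over the challenge and over the answer; the comparison of
lengths is computable and costs nothing. -/
theorem sigmaIn_not_listBackForth (n : ℕ) {A B : S.language.Structure ℕ}
    (hA : IsComputableStructure S A) (hB : IsComputableStructure S B) :
    SigmaIn ∅ (2 * n) fun x : List ℕ × List ℕ => ¬ ListBackForth S n A B x.1 x.2 := by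
  induction n generalizing A B with
  | zero =>
    obtain ⟨q, hq, h⟩ := computable_listBackForth_zero hA hB
    exact ⟨q, hq.computableIn, h⟩
  | succ n ih =>
    have hf : Computable fun x : (List ℕ × List ℕ) × List ℕ => (x.1.2 ++ x.2, x.1.1) :=
      (Computable.list_append.comp (Computable.snd.comp Computable.fst) Computable.snd).pair
        (Computable.fst.comp Computable.fst)
    have h := ((ih hB hA).extendible_of_not.comp hf).exists_not
    have hq : Computable fun x : List ℕ × List ℕ => !decide (x.1.length = x.2.length) :=
      (Primrec.not.comp (Primrec.eq.decide.comp (Primrec.list_length.comp Primrec.fst)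
        (Primrec.list_length.comp Primrec.snd))).to_comp
    have h' := (h.and_or hq).2
    have e : (fun x : List ℕ × List ℕ => (!decide (x.1.length = x.2.length)) = true ∨
        ∃ b, ¬ Extendible S n B A (x.2 ++ b) x.1) =
        fun x => ¬ ListBackForth S (n + 1) A B x.1 x.2 := by
      funext x
      simp only [ListBackForth, Extendible, Bool.not_eq_true', decide_eq_false_iff_not, not_and_or,
        not_forall]
    exact e ▸ h'

/-! ### Separating formulas -/

/-- The families `G` of `Σₙ` formulas such that `G m (b, a)` is true in `A` of every `m`-tuple
extending `a` and false in `B` of the `m`-tuple `b`, unless `a` has an extension `a⁺` with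
`(B, b) ≤ₙ (A, a⁺)`. -/
def Separates (A B : S.language.Structure ℕ) {n : ℕ}
    (G : (m : ℕ) → List ℕ × List ℕ → InfFormula S .sigma n m) : Prop :=
  ∀ (m : ℕ) (b a : List ℕ), b.length = m → ¬ Extendible S n B A b a →
    (∀ v : Fin m → ℕ, a <+: List.ofFn v → (G m (b, a)).Realize A v) ∧
      ∀ v : Fin m → ℕ, List.ofFn v = b → ¬ (G m (b, a)).Realize B v

/-- Disjunction with a structure-independent formula for `Extendible` makes the family trivially
true where it need not separate, and changes no truth value where it must. The price is one jump. -/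
theorem Separates.exists_total {A B : S.language.Structure ℕ} (hA : IsComputableStructure S A)
    (hB : IsComputableStructure S B) {n : ℕ}
    {G : (m : ℕ) → List ℕ × List ℕ → InfFormula S .sigma n m}
    (hG : UniformlyIn (zeroJump n) G) (h : Separates A B G) :
    ∃ H : (m : ℕ) → List ℕ × List ℕ → InfFormula S .sigma n m,
      UniformlyIn (zeroJump (n + 1)) H ∧ Separates A B H ∧
      ∀ (C : S.language.Structure ℕ) (m : ℕ) (b a : List ℕ), Extendible S n B A b a →
        ∀ v : Fin m → ℕ, (H m (b, a)).Realize C v := by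
  have hr : SigmaIn (zeroJump (n + 1)) n
      fun x : List ℕ × List ℕ => Extendible S n B A x.1 x.2 := by
    -- Of the `2 * n + 1` quantifiers in `Extendible`, `n + 1` go into the oracle and `n` into the
    -- formula.
    refine SigmaIn.zeroJump ?_
    have := (sigmaIn_not_listBackForth n hB hA).extendible_of_not
    rwa [show 2 * n + 1 = n + (n + 1) by omega] at this
  obtain ⟨Φ, hΦ, hΦr⟩ := hr.exists_uniformlyIn S
  refine ⟨fun m x => (Φ m x).or (G m x), hΦ.or (hG.mono (zeroJump_mono n.le_succ)), ?_, ?_⟩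
  · intro m b a hb hba
    simp only [InfFormula.realize_or, hΦr, hba, false_or]
    exact h m b a hb hba
  · intro C m b a hba v
    exact (InfFormula.realize_or C _ _ v).mpr (.inl ((hΦr C m (b, a) v).mpr hba))

/-- The formula denies that the variables have the atomic type of `b`. A tuple of `A` extending `a`
that had this type would itself be the excluded extension of `a`. -/
theorem exists_separates_zero {A B : S.language.Structure ℕ} (hB : IsComputableStructure S B) :
    ∃ G : (m : ℕ) → List ℕ × List ℕ → InfFormula S .sigma 0 m,
      UniformlyIn (zeroJump 0) G ∧ Separates A B G := by
  obtain ⟨q, hq, hqB⟩ := hB.exists_atomHolds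
  have hN : Computable fun x : ℕ × List ℕ × List ℕ =>
      S.disagreementNumber (q x.2.1) (S.atoms x.1) :=
    computable_disagreementNumber (q := fun x : ℕ × List ℕ × List ℕ => q x.2.1)
      (hq.comp (Computable.fst.comp (Computable.snd.comp Computable.fst)) Computable.snd)
      (S.computable_atoms.comp Computable.fst)
  refine ⟨_, UniformlyIn.qf (θ := fun m x => disagreement m (q x.1) (S.atoms m))
    (fun _ _ => isQF_disagreement _ _ _) hN.computableIn
    fun m a => formulaNumber_disagreement _ fun _ h => h, ?_⟩
  intro m b a hb hba
  obtain ⟨w, rfl⟩ := List.exists_ofFn_eq hb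
  constructor
  · rintro v ⟨u, hu⟩
    refine (realize_disagreement A v _ _).mpr fun h => hba ⟨u, m, w, v, rfl, hu.symm, fun ℓ hℓ => ?_⟩
    rw [← hqB m w ℓ hℓ, h ℓ hℓ]
  · intro v hv h
    obtain rfl := List.ofFn_injective hv
    exact (realize_disagreement B v _ _).mp h fun ℓ hℓ => hqB m v ℓ hℓ

/-- The list with a given code. -/
def listOfCode (i : ℕ) : List ℕ :=
  (Encodable.decode i).getD []

theorem computable_listOfCode : Computable listOfCode :=
  Computable.decode.option_getD (Computable.const [])

theorem exists_separates_succ {n : ℕ} {A B : S.language.Structure ℕ}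
    {H : (m : ℕ) → List ℕ × List ℕ → InfFormula S .sigma n m}
    (hH : UniformlyIn (zeroJump (n + 1)) H) (hs : Separates B A H)
    (ht : ∀ (C : S.language.Structure ℕ) (m : ℕ) (b a : List ℕ), Extendible S n A B b a →
      ∀ v : Fin m → ℕ, (H m (b, a)).Realize C v) :
    ∃ G : (m : ℕ) → List ℕ × List ℕ → InfFormula S .sigma (n + 1) m,
      UniformlyIn (zeroJump (n + 1)) G ∧ Separates A B G := by
  have hext : Computable fun x : (List ℕ × List ℕ) × ℕ => x.1.2 ++ listOfCode x.2 :=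
    Computable.list_append.comp (Computable.snd.comp Computable.fst)
      (computable_listOfCode.comp Computable.snd)
  have hlen : Computable fun x : ℕ × (List ℕ × List ℕ) × ℕ =>
      (x.2.1.2 ++ listOfCode x.2.2).length :=
    Computable.list_length.comp (hext.comp Computable.snd)
  -- Only lists with at least `m` entries index a disjunct, so the truncated subtraction giving the
  -- number of quantified variables is exact.
  have hI : Computable fun x : ℕ × (List ℕ × List ℕ) × ℕ =>
      decide (x.1 ≤ (x.2.1.2 ++ listOfCode x.2.2).length) :=
    Computable₂.comp (f := fun i j : ℕ => decide (i ≤ j)) Primrec.nat_le.decide.to_comp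
      Computable.fst hlen
  have hsub : Computable fun x : ℕ × (List ℕ × List ℕ) × ℕ =>
      (x.2.1.2 ++ listOfCode x.2.2).length - x.1 :=
    Computable₂.comp (f := fun i j : ℕ => i - j) Primrec.nat_sub.to_comp hlen Computable.fst
  have hg : Computable fun x : (List ℕ × List ℕ) × ℕ => (x.1.2 ++ listOfCode x.2, x.1.1) :=
    hext.pair (Computable.fst.comp Computable.fst)
  have hU := UniformlyIn.disj hH.negSigma hI hsub hg
  refine ⟨_, hU, fun m b a hb hba => ⟨fun v hv => ?_, fun v hv h => ?_⟩⟩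
  · obtain ⟨u, hu⟩ := hv
    have hlv : b.length = (List.ofFn v).length := by simp [hb]
    have hnot : ¬ ListBackForth S (n + 1) B A b (List.ofFn v) := fun h => hba ⟨u, hu.symm ▸ h⟩
    -- The failure of the relation for `v` itself yields a challenge `c` in `A` without an answer in
    -- `B`; `v` followed by `c` selects the true disjunct and `c` is the witness in it.
    obtain ⟨c, hc⟩ : ∃ c, ∀ d, ¬ ListBackForth S n A B (List.ofFn v ++ c) (b ++ d) := by
      by_contra! h
      exact hnot ⟨hlv, h⟩
    obtain ⟨i, hi⟩ : ∃ i, a ++ listOfCode i = List.ofFn v ++ c :=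
      ⟨Encodable.encode (u ++ c), by simp [listOfCode, ← hu]⟩
    have hl : c.length = (a ++ listOfCode i).length - m := by simp [hi]
    obtain ⟨w, hw⟩ := List.exists_ofFn_eq hl
    have hne : ¬ Extendible S n A B (a ++ listOfCode i) b := by
      rw [hi]
      exact fun ⟨d, hd⟩ => hc d hd
    have hle : m ≤ (a ++ listOfCode i).length := by simp [hi]
    refine ⟨⟨i, decide_eq_true hle⟩, w, (InfFormula.realize_negSigma A _ _).mpr ?_⟩
    exact (hs _ _ _ (Nat.add_sub_cancel' hle).symm hne).2 _
      (by rw [List.ofFn_fin_append, hw, hi])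
  · obtain ⟨⟨i, hi⟩, w, hw⟩ := h
    have hle : m ≤ (a ++ listOfCode i).length := of_decide_eq_true hi
    refine (InfFormula.realize_negSigma B _ _).mp hw ?_
    -- For a bad index the formula of `H` is true everywhere; otherwise it holds in `B` of every
    -- tuple extending `b`, in particular of `b` followed by the arbitrary witness `w`.
    by_cases he : Extendible S n A B (a ++ listOfCode i) b
    · exact ht B _ _ _ he _
    · exact (hs _ _ _ (Nat.add_sub_cancel' hle).symm he).1 _
        ⟨List.ofFn w, by rw [List.ofFn_fin_append, hv]⟩

theorem exists_separates (n : ℕ) {A B : S.language.Structure ℕ} (hA : IsComputableStructure S A)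
    (hB : IsComputableStructure S B) :
    ∃ G : (m : ℕ) → List ℕ × List ℕ → InfFormula S .sigma n m,
      UniformlyIn (zeroJump n) G ∧ Separates A B G := by
  induction n generalizing A B with
  | zero => exact exists_separates_zero hB
  | succ n ih =>
    obtain ⟨G, hG, hs⟩ := ih hB hA
    obtain ⟨H, hH, hs, ht⟩ := hs.exists_total hB hA hG
    exact exists_separates_succ hH hs ht

end BackAndForth

/-! ### The universal closure and the theorem -/

/-- The universal closure of a uniformly computable family is computable. -/
theorem UniformlyIn.forall {X : Set ℕ} {S : CompSignature} {n : ℕ} {α : Type} [Primcodable α]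
    {G : (m : ℕ) → α → InfFormula S .sigma n m} (hG : UniformlyIn X G) (k : ℕ) (a : α) :
    (InfFormula.conj {0} (fun _ => k) fun _ => G (0 + k) a : InfFormula S .pi (n + 1) 0).ComputableFrom
      X := by
  have hT : ComputableIn {charOracle X} fun σ : List ℕ => (G (0 + k) a).tree k σ.tail :=
    ComputableIn.comp (f := fun x : (ℕ × α) × ℕ × List ℕ => (G x.1.1 x.1.2).tree x.2.1 x.2.2) hG
      ((Primrec.const (0 + k, a)).pair ((Primrec.const k).pair Primrec.list_tail)).computableIn
  have h : Primrec fun x : List ℕ × Option (ℕ × ℕ) =>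
      if x.1 = [] then some (0, 0) else if x.1.headI = 0 then x.2 else none :=
    Primrec.ite (Primrec.eq.comp Primrec.fst (Primrec.const [])) (Primrec.const _)
      (Primrec.ite (Primrec.eq.comp (Primrec.list_headI.comp Primrec.fst) (Primrec.const 0))
        Primrec.snd (Primrec.const none))
  refine (h.computableIn.comp (ComputableIn.id.pair hT)).of_eq ?_
  rintro (_ | ⟨i, σ⟩)
  · rfl
  · by_cases hi : i = 0 <;> simp [InfFormula.tree, hi]

theorem mainTheorem9 (S : CompSignature) (A B : S.language.Structure ℕ)
    (hA : IsComputableStructure S A) (hB : IsComputableStructure S B)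
    (n : ℕ) (hn : 1 ≤ n) (hAB : ¬ StructureLE S n A B) :
    ∃ φ : InfFormula S FormulaSort.pi n 0,
      φ.ComputableFrom (zeroJump (n - 1)) ∧ SentenceHolds A φ ∧ ¬ SentenceHolds B φ := by
  obtain ⟨n, rfl⟩ := Nat.exists_eq_add_of_le' hn
  rw [Nat.add_sub_cancel]
  simp only [StructureLE, BackForth, not_forall, not_exists] at hAB
  obtain ⟨k, b, hb⟩ := hAB
  obtain ⟨G, hG, hs⟩ := exists_separates n hA hB
  have happ (w : Fin k → ℕ) : List.ofFn (Fin.append (Fin.elim0 : Fin 0 → ℕ) w) = List.ofFn w := by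
    rw [List.ofFn_fin_append]
    simp
  -- Every tuple extends the empty one, and the length condition leaves only `k`-tuples of `A`,
  -- which are excluded by the choice of `b`.
  have hext : ¬ Extendible S n B A (List.ofFn b) [] := by
    rintro ⟨u, hu⟩
    obtain ⟨a, rfl⟩ := List.exists_ofFn_eq (m := k) (l := u) (by simpa using hu.length_eq.symm)
    rw [List.nil_append, ← happ a, ← happ b] at hu
    exact hb a hu.backForth
  obtain ⟨h₁, h₂⟩ := hs (0 + k) (List.ofFn b) [] (by simp) hext
  refine ⟨_, hG.forall k (List.ofFn b, []), fun i w => h₁ _ List.nil_prefix, fun h => ?_⟩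
  exact h₂ (Fin.append Fin.elim0 b) (happ b) (h ⟨0, rfl⟩ b)
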